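/- Let $k$ be a field. A Poisson algebra over $k$ is a commutative $k$-algebra $Z$ with a $k$-bilinear bracket $\{\cdot,\cdot\}$ that makes $Z$ a Lie algebra and is a derivation in each argument. A Poisson order over $Z$ is a (not necessarily commutative) $Z$-algebra $A$, finitely generated as a $Z$-module, with a $k$-bilinear map $\{\cdot,\cdot\}:Z\times A\to A$ which extends the bracket of $Z$ (that is, $\{x,y1_A\}=\{x,y\}1_A$ for $x,y\in Z$) and satisfies, for all $x,y\in Z$ and $a,b\in A$, $$\{x,ab\}=\{x,a\}b+a\{x,b\},\qquad \{xy,a\}=x\{y,a\}+y\{x,a\},\qquad \{\{x,y\},a\}=\{x,\{y,a\}\}-\{y,\{x,a\}\}.$$ The Poisson enveloping algebra $A^e$ is the associative unital $k$-algebra generated by symbols $\alpha(a)$ $(a\in A)$ and $\delta(z)$ $(z\in Z)$ subject to the relations that $\alpha$ is a unital $k$-algebra homomorphism, $\delta$ is a homomorphism of Lie algebras over $k$, and $\alpha(\{x,a\})=[\delta(x),\alpha(a)]$, $\delta(xy)=\alpha(x1_A)\delta(y)+\alpha(y1_A)\delta(x)$ for all $x,y\in Z$, $a\in A$. In particular $Z$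 is a Poisson order over itself, with enveloping algebra $Z^e$, and there is a natural homomorphism $Z^e\to A^e$ with $\alpha(z)\mapsto\alpha(z1_A)$ and $\delta(z)\mapsto\delta(z)$. **Corollary.** Let $Z$ be a Poisson algebra over $k$ that is regular and affine, i.e. finitely generated with $\operatorname{Spec}(Z)$ smooth over $k$, and let $A$ be a Poisson order over $Z$. (i) If $A$ is a faithful $Z$-module, then the natural map $Z^e\to A^e$ is injective. (ii) If $A$ is a free $Z$-module, then $A^e$ is free both as a left and as a right $Z^e$-module. (iii) If $A$ is a projective $Z$-module, then $A^e$ is projective both as a left and as a right $Z^e$-module. (iv) $A^e$ is projective and faithfully flat both as a left and as a right $A$-module via $\alpha$. If moreover the rank function $\mathfrak p\mapsto \operatorname{rank}_{Z_{\mathfrak p}}(\Omega_{Z/k})_{\mathfrak p}$ on $\operatorname{Spec}(Z)$ is either identically zero or nowhere zero (for instance, if $\operatorname{Spec}(Z)$ is connected), then $A^e$ is free both as a left and as a right $A$-module. Here an $R$-module $E$ over a possibly noncommutative ring $R$ is called faithfully flat if a sequence of $R$-modules (on the other side) is exact if and only if it becomes exact after tensoring over $R$ with $E$. -/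

import Mathlib

open scoped TensorProduct KaehlerDifferential

universe u v w x

/-- A Poisson algebra over `k`: a commutative `k`-algebra `Z` with a `k`-bilinear bracket which
makes `Z` into a Lie algebra over `k` and which is a derivation in each argument. -/
class PoissonAlgebra (k : Type u) (Z : Type v) [Field k] [CommRing Z] [Algebra k Z] where
  /-- The Poisson bracket. -/
  bracket : Z →ₗ[k] Z →ₗ[k] Z
  bracket_self : ∀ z : Z, bracket z z = 0
  jacobi : ∀ z₁ z₂ z₃ : Z,
    bracket (bracket z₁ z₂) z₃ = bracket z₁ (bracket z₂ z₃) - bracket z₂ (bracket z₁ z₃)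
  leibniz : ∀ z z₁ z₂ : Z, bracket z (z₁ * z₂) = bracket z z₁ * z₂ + z₁ * bracket z z₂

/-- A Poisson order `A` over a Poisson algebra `Z`: a (not necessarily commutative) `Z`-algebra,
finitely generated as a `Z`-module, with a `k`-bilinear map `Z × A → A` extending the Poisson
bracket of `Z`, which is a biderivation and is a Lie algebra action of `Z` on `A`. -/
class PoissonOrder (k : Type u) (Z : Type v) (A : Type w) [Field k] [CommRing Z] [Algebra k Z]
    [PoissonAlgebra k Z] [Ring A] [Algebra k A] [Algebra Z A] [IsScalarTower k Z A] where
  finite : Module.Finite Z A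
  /-- The map `(z, a) ↦ {z, a}`; the derivation `ham z` is the Hamiltonian derivation of `z`. -/
  ham : Z →ₗ[k] A →ₗ[k] A
  ham_algebraMap : ∀ z z' : Z,
    ham z (algebraMap Z A z') = algebraMap Z A (PoissonAlgebra.bracket (k := k) z z')
  ham_mul : ∀ (z : Z) (a b : A), ham z (a * b) = ham z a * b + a * ham z b
  mul_ham : ∀ (z z' : Z) (a : A), ham (z * z') a = z • ham z' a + z' • ham z a
  ham_bracket : ∀ (z z' : Z) (a : A),
    ham (PoissonAlgebra.bracket (k := k) z z') a = ham z (ham z' a) - ham z' (ham z a)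

namespace PoissonAlgebra

variable {k : Type u} {Z : Type v} [Field k] [CommRing Z] [Algebra k Z] [PoissonAlgebra k Z]

theorem bracket_swap (z z' : Z) : bracket (k := k) z z' = - bracket (k := k) z' z := by
  have h := bracket_self (k := k) (Z := Z) (z + z')
  simp only [map_add, LinearMap.add_apply, bracket_self, zero_add, add_zero] at h
  exact eq_neg_of_add_eq_zero_right h

/-- Every Poisson algebra is a Poisson order over itself. -/
instance : PoissonOrder k Z Z where
  finite := inferInstance
  ham := bracket
  ham_algebraMap _ _ := rfl
  ham_mul := leibniz
  mul_ham z z' a := by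
    rw [bracket_swap (z * z') a, leibniz, bracket_swap a z, bracket_swap a z']
    simp only [smul_eq_mul]
    ring
  ham_bracket := jacobi

end PoissonAlgebra

section Enveloping

variable (k : Type u) (Z : Type v) (A : Type w) [Field k] [CommRing Z] [Algebra k Z]
  [PoissonAlgebra k Z] [Ring A] [Algebra k A] [Algebra Z A] [IsScalarTower k Z A]
  [PoissonOrder k Z A]

/-- The defining relations of the Poisson enveloping algebra, on the free `k`-algebra on symbols
`α a` (`a : A`, the left summand) and `δ z` (`z : Z`, the right summand). The first three say that
`α` is a unital `k`-algebra homomorphism, the next three that `δ` is a homomorphism of Lie algebras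
over `k`; the last two are `α {z, a} = [δ z, α a]` and `δ (z z') = α z δ z' + α z' δ z`. -/
inductive PoissonEnv.Rel : FreeAlgebra k (A ⊕ Z) → FreeAlgebra k (A ⊕ Z) → Prop
  | alpha_add (a b : A) : PoissonEnv.Rel (FreeAlgebra.ι k (Sum.inl (a + b)))
      (FreeAlgebra.ι k (Sum.inl a) + FreeAlgebra.ι k (Sum.inl b))
  | alpha_mul (a b : A) : PoissonEnv.Rel (FreeAlgebra.ι k (Sum.inl (a * b)))
      (FreeAlgebra.ι k (Sum.inl a) * FreeAlgebra.ι k (Sum.inl b))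
  | alpha_algebraMap (c : k) : PoissonEnv.Rel (FreeAlgebra.ι k (Sum.inl (algebraMap k A c)))
      (algebraMap k (FreeAlgebra k (A ⊕ Z)) c)
  | delta_add (z z' : Z) : PoissonEnv.Rel (FreeAlgebra.ι k (Sum.inr (z + z')))
      (FreeAlgebra.ι k (Sum.inr z) + FreeAlgebra.ι k (Sum.inr z'))
  | delta_smul (c : k) (z : Z) : PoissonEnv.Rel (FreeAlgebra.ι k (Sum.inr (c • z)))
      (c • FreeAlgebra.ι k (Sum.inr z))
  | delta_bracket (z z' : Z) :
      PoissonEnv.Rel (FreeAlgebra.ι k (Sum.inr (PoissonAlgebra.bracket (k := k) z z')))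
      (FreeAlgebra.ι k (Sum.inr z) * FreeAlgebra.ι k (Sum.inr z')
        - FreeAlgebra.ι k (Sum.inr z') * FreeAlgebra.ι k (Sum.inr z))
  | alpha_ham (z : Z) (a : A) :
      PoissonEnv.Rel (FreeAlgebra.ι k (Sum.inl (PoissonOrder.ham (k := k) z a)))
      (FreeAlgebra.ι k (Sum.inr z) * FreeAlgebra.ι k (Sum.inl a)
        - FreeAlgebra.ι k (Sum.inl a) * FreeAlgebra.ι k (Sum.inr z))
  | delta_mul (z z' : Z) : PoissonEnv.Rel (FreeAlgebra.ι k (Sum.inr (z * z')))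
      (FreeAlgebra.ι k (Sum.inl (algebraMap Z A z)) * FreeAlgebra.ι k (Sum.inr z')
        + FreeAlgebra.ι k (Sum.inl (algebraMap Z A z')) * FreeAlgebra.ι k (Sum.inr z))

/-- The Poisson enveloping algebra `A^e` of the Poisson order `A` over `Z`. -/
def PoissonEnv : Type (max u v w) := RingQuot (PoissonEnv.Rel k Z A)

namespace PoissonEnv

noncomputable instance : Ring (PoissonEnv k Z A) :=
  inferInstanceAs (Ring (RingQuot (PoissonEnv.Rel k Z A)))

noncomputable instance : Algebra k (PoissonEnv k Z A) :=
  inferInstanceAs (Algebra k (RingQuot (PoissonEnv.Rel k Z A)))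

/-- The quotient map from the free algebra. -/
noncomputable def mk : FreeAlgebra k (A ⊕ Z) →ₐ[k] PoissonEnv k Z A :=
  RingQuot.mkAlgHom k (PoissonEnv.Rel k Z A)

theorem mk_rel {s t : FreeAlgebra k (A ⊕ Z)} (h : Rel k Z A s t) : mk k Z A s = mk k Z A t :=
  RingQuot.mkAlgHom_rel k h

/-- The canonical algebra homomorphism `α : A → A^e`. -/
noncomputable def alpha : A →ₐ[k] PoissonEnv k Z A :=
  AlgHom.ofLinearMap
    { toFun := fun a => mk k Z A (FreeAlgebra.ι k (Sum.inl a))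
      map_add' := fun a b => by rw [mk_rel k Z A (Rel.alpha_add a b), map_add]
      map_smul' := fun c a => by
        rw [Algebra.smul_def, mk_rel k Z A (Rel.alpha_mul _ _), map_mul,
          mk_rel k Z A (Rel.alpha_algebraMap c), AlgHom.commutes, ← Algebra.smul_def,
          RingHom.id_apply] }
    (by
      change mk k Z A (FreeAlgebra.ι k (Sum.inl 1)) = 1
      rw [← map_one (algebraMap k A), mk_rel k Z A (Rel.alpha_algebraMap 1), map_one, map_one])
    (fun a b => by
      change mk k Z A (FreeAlgebra.ι k (Sum.inl (a * b))) = _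
      rw [mk_rel k Z A (Rel.alpha_mul a b), map_mul]
      rfl)

/-- The canonical map `δ : Z → A^e`. -/
noncomputable def delta : Z →ₗ[k] PoissonEnv k Z A where
  toFun z := mk k Z A (FreeAlgebra.ι k (Sum.inr z))
  map_add' z z' := by rw [mk_rel k Z A (Rel.delta_add z z'), map_add]
  map_smul' c z := by rw [mk_rel k Z A (Rel.delta_smul c z), map_smul, RingHom.id_apply]

theorem delta_bracket (z z' : Z) : delta k Z A (PoissonAlgebra.bracket (k := k) z z') =
    delta k Z A z * delta k Z A z' - delta k Z A z' * delta k Z A z := by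
  have h := mk_rel k Z A (Rel.delta_bracket z z')
  rw [map_sub, map_mul, map_mul] at h
  exact h

theorem alpha_ham (z : Z) (a : A) : alpha k Z A (PoissonOrder.ham (k := k) z a) =
    delta k Z A z * alpha k Z A a - alpha k Z A a * delta k Z A z := by
  have h := mk_rel k Z A (Rel.alpha_ham z a)
  rw [map_sub, map_mul, map_mul] at h
  exact h

theorem delta_mul (z z' : Z) : delta k Z A (z * z') =
    alpha k Z A (algebraMap Z A z) * delta k Z A z' +
      alpha k Z A (algebraMap Z A z') * delta k Z A z := by
  have h := mk_rel k Z A (Rel.delta_mul z z')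
  rw [map_add, map_mul, map_mul] at h
  exact h

/-- The natural homomorphism `Z^e → A^e`, which sends `α z` to `α (z 1_A)` and `δ z` to `δ z`. -/
noncomputable def natMap : PoissonEnv k Z Z →ₐ[k] PoissonEnv k Z A :=
  RingQuot.liftAlgHom k
    ⟨FreeAlgebra.lift k
      (Sum.elim (fun z => alpha k Z A (algebraMap Z A z)) (fun z => delta k Z A z)), by
      intro s t h
      induction h with
      | alpha_add a b => simp
      | alpha_mul a b => simp
      | alpha_algebraMap c =>
        simp [← IsScalarTower.algebraMap_apply k Z A]
      | delta_add z z' => simp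
      | delta_smul c z => simp
      | delta_bracket z z' => simp [delta_bracket]
      | alpha_ham z a =>
        have h := alpha_ham k Z A z (algebraMap Z A a)
        rw [PoissonOrder.ham_algebraMap] at h
        simp only [FreeAlgebra.lift_ι_apply, Sum.elim_inl, Sum.elim_inr, map_sub, map_mul]
        exact h
      | delta_mul z z' => simp [delta_mul]⟩

theorem natMap_alpha (z : Z) :
    natMap k Z A (alpha k Z Z z) = alpha k Z A (algebraMap Z A z) := by
  change RingQuot.liftAlgHom k _ (RingQuot.mkAlgHom k _ _) = _
  simp

theorem natMap_delta (z : Z) : natMap k Z A (delta k Z Z z) = delta k Z A z := by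
  change RingQuot.liftAlgHom k _ (RingQuot.mkAlgHom k _ _) = _
  simp

end PoissonEnv

end Enveloping

section BalancedTensor

/-- The tensor product `M ⊗_R N` of a right module `M` and a left module `N` over a possibly
noncommutative ring `R`, as an abelian group. -/
def BalancedTensor (R : Type u) (M : Type v) (N : Type w) [Ring R] [AddCommGroup M]
    [AddCommGroup N] [Module Rᵐᵒᵖ M] [Module R N] : Type (max v w) :=
  (M ⊗[ℤ] N) ⧸ AddSubgroup.closure
    {t : M ⊗[ℤ] N | ∃ (m : M) (r : R) (n : N),
      t = (MulOpposite.op r • m) ⊗ₜ[ℤ] n - m ⊗ₜ[ℤ] (r • n)}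

namespace BalancedTensor

variable {R : Type u} [Ring R]

noncomputable instance (M : Type v) (N : Type w) [AddCommGroup M] [AddCommGroup N]
    [Module Rᵐᵒᵖ M] [Module R N] : AddCommGroup (BalancedTensor R M N) :=
  inferInstanceAs (AddCommGroup ((M ⊗[ℤ] N) ⧸ AddSubgroup.closure
    {t : M ⊗[ℤ] N | ∃ (m : M) (r : R) (n : N),
      t = (MulOpposite.op r • m) ⊗ₜ[ℤ] n - m ⊗ₜ[ℤ] (r • n)}))

/-- The map `f ⊗ g : M ⊗_R N → M' ⊗_R N'`. -/
noncomputable def map {M M' : Type v} {N N' : Type w} [AddCommGroup M] [AddCommGroup M']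
    [AddCommGroup N] [AddCommGroup N'] [Module Rᵐᵒᵖ M] [Module Rᵐᵒᵖ M'] [Module R N] [Module R N']
    (f : M →ₗ[Rᵐᵒᵖ] M') (g : N →ₗ[R] N') : BalancedTensor R M N →+ BalancedTensor R M' N' :=
  QuotientAddGroup.map _ _
    (TensorProduct.map f.toAddMonoidHom.toIntLinearMap
      g.toAddMonoidHom.toIntLinearMap).toAddMonoidHom
    (by
      rw [AddSubgroup.closure_le]
      rintro _ ⟨m, r, n, rfl⟩
      refine AddSubgroup.subset_closure ⟨f m, r, g n, ?_⟩
      simp)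

end BalancedTensor

/-- A left `R`-module `E` is faithfully flat if a sequence of right `R`-modules is exact if and only
if it is exact after applying `- ⊗_R E`. -/
def IsFaithfullyFlatLeft (R : Type u) (E : Type v) [Ring R] [AddCommGroup E] [Module R E] : Prop :=
  ∀ (M₁ M₂ M₃ : Type x) [AddCommGroup M₁] [AddCommGroup M₂] [AddCommGroup M₃]
    [Module Rᵐᵒᵖ M₁] [Module Rᵐᵒᵖ M₂] [Module Rᵐᵒᵖ M₃] (f : M₁ →ₗ[Rᵐᵒᵖ] M₂) (g : M₂ →ₗ[Rᵐᵒᵖ] M₃),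
    Function.Exact f g ↔
      Function.Exact (BalancedTensor.map f (LinearMap.id : E →ₗ[R] E))
        (BalancedTensor.map g (LinearMap.id : E →ₗ[R] E))

/-- A right `R`-module `E` is faithfully flat if a sequence of left `R`-modules is exact if and only
if it is exact after applying `E ⊗_R -`. -/
def IsFaithfullyFlatRight (R : Type u) (E : Type v) [Ring R] [AddCommGroup E] [Module Rᵐᵒᵖ E] :
    Prop :=
  ∀ (N₁ N₂ N₃ : Type x) [AddCommGroup N₁] [AddCommGroup N₂] [AddCommGroup N₃]
    [Module R N₁] [Module R N₂] [Module R N₃] (f : N₁ →ₗ[R] N₂) (g : N₂ →ₗ[R] N₃),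
    Function.Exact f g ↔
      Function.Exact (BalancedTensor.map (LinearMap.id : E →ₗ[Rᵐᵒᵖ] E) f)
        (BalancedTensor.map (LinearMap.id : E →ₗ[Rᵐᵒᵖ] E) g)

end BalancedTensor

namespace RingHom

variable {R : Type u} {S : Type v} [Ring R] [Ring S] (f : R →+* S)

/-- `S` as a left `R`-module through `f`: `r • s = f r * s`. -/
abbrev leftModule : Module R S := Module.compHom S f

/-- `S` as a right `R`-module through `f`: `s • r = s * f r`. -/
abbrev rightModule : Module Rᵐᵒᵖ S := Module.compHom S (RingHom.op f)

/-- `S` is free as a left and as a right `R`-module. -/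
def FreeBothSides : Prop :=
  @Module.Free R S _ _ f.leftModule ∧ @Module.Free Rᵐᵒᵖ S _ _ f.rightModule

/-- `S` is projective as a left and as a right `R`-module. -/
def ProjectiveBothSides : Prop :=
  @Module.Projective R _ S _ f.leftModule ∧ @Module.Projective Rᵐᵒᵖ _ S _ f.rightModule

/-- `S` is faithfully flat as a left and as a right `R`-module. -/
def FaithfullyFlatBothSides : Prop :=
  @IsFaithfullyFlatLeft.{u, v, x} R S _ _ f.leftModule ∧
    @IsFaithfullyFlatRight.{u, v, x} R S _ _ f.rightModule

end RingHom

set_option linter.unusedSectionVars false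

/-! ### The Poincaré–Birkhoff–Witt theorem for Lie–Rinehart algebras with a basis -/

namespace LieRinehartPBW

variable {R L I : Type*} [CommRing R] [LieRing L] [Module R L] [LieRingModule L R]
  [LieRinehartRing R L]

/-! The bracket [dx, dy] = d{x, y} and the anchor r dx ↦ r{x, -} make the module Ω of Kähler
differentials a Lie–Rinehart algebra over Z. The map δ factors through Ω (`ofKaehler`), and Z^e
behaves as its enveloping algebra. If Ω were free, the Poincaré–Birkhoff–Witt theorem would make Z^e
free on ordered monomials. Smoothness only makes Ω finitely generated projective, but by the
Eilenberg swindle Ω ⊕ Z^(ℕ) ≅ Z^(ℕ). This sum is again a Lie–Rinehart algebra, with Z^(ℕ) an abelian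
ideal, so it has a basis and acts on polynomials in that basis (`act_lie`). Hence Z^e acts there
too; letting it act on the monomial 1 gives a Z-linear map `pbwSymbol` into a free module.
Evaluating ordered monomials in Z^e, with the added summand acting by zero, is a retraction
(`pbwEval_pbwSymbol`). So Z^e is projective and countably generated over Z.

If Ω has nowhere zero rank, it is a generator, and leading terms of powers of differentials yield a
surjection Z^e → Z^(ℕ) (`slots_pbwSymbol_surjective`); a second swindle makes Z^e free. If the rank
is identically zero, then Ω = 0 and Z^e = Z.

For a Poisson order, A^e ≅ A ⊗_Z Z^e (`tensorEquiv`), the inverse of multiplication coming from an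
action of A^e on A ⊗_Z Z^e. This gives (i) by flatness of Z^e, the left A-module statements by base
change, and the right Z^e-module statements by carrying coordinates of A over Z to A^e. The other
sides follow by applying these results to A^op over Z with the negated bracket, whose enveloping
algebra is (A^e)^op (`opEquiv`). Finally A^e is projective over A and the augmentation `aug` splits
off a copy of A, whence faithful flatness (`exact_iff_of_natural_retracts`). -/

theorem lie_one (x : L) : ⁅x, (1 : R)⁆ = 0 := by
  have h := LieRinehartRing.leibniz_mul_right x (1 : R) 1
  simpa using h

/-- The submodule of combinations of monomials of degree at most `n`. -/
abbrev degLE (R I : Type*) [CommRing R] (n : ℕ) : Submodule R (Multiset I →₀ R) :=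
  Finsupp.supported R R {s | s.card ≤ n}

theorem degLE_mono {m n : ℕ} (h : m ≤ n) : degLE R I m ≤ degLE R I n :=
  Finsupp.supported_mono fun _ hs => le_trans hs h

theorem single_mem_degLE {n : ℕ} {s : Multiset I} (h : s.card ≤ n) (r : R) :
    Finsupp.single s r ∈ degLE R I n :=
  Finsupp.single_mem_supported R r h

theorem degLE_induction {n : ℕ} {P : (Multiset I →₀ R) → Prop} (zero : P 0)
    (add : ∀ v w, P v → P w → P (v + w))
    (smul_single : ∀ (r : R) (s : Multiset I), s.card ≤ n → P (r • Finsupp.single s 1))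
    (v : Multiset I →₀ R) (hv : v ∈ degLE R I n) : P v := by
  rw [← Finsupp.sum_single v]
  refine Finset.sum_induction _ P add zero fun s hs => ?_
  have h := smul_single (v s) s (hv hs)
  rwa [Finsupp.smul_single_one] at h

theorem finsupp_induction {P : (Multiset I →₀ R) → Prop} (zero : P 0)
    (add : ∀ v w, P v → P w → P (v + w))
    (smul_single : ∀ (r : R) (s : Multiset I), P (r • Finsupp.single s 1))
    (v : Multiset I →₀ R) : P v := by
  rw [← Finsupp.sum_single v]
  refine Finset.sum_induction _ P add zero fun s hs => ?_
  have h := smul_single (v s) s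
  rwa [Finsupp.smul_single_one] at h

/-! ### Operators with prescribed values on monomials -/

variable (b : Module.Basis I R L)

/-- The operator on polynomials by which `x : L` acts, given the values `A i s` of the basis
elements on the monomials. -/
noncomputable def op (A : I → Multiset I → (Multiset I →₀ R)) (x : L) :
    (Multiset I →₀ R) →+ (Multiset I →₀ R) :=
  -- Differentiating the coefficients and extending the prescribed values R-linearly is forced by
  -- the Leibniz rule `op_smul`.
  Finsupp.mapRange.addMonoidHom (LieRingModule.toEnd L R x : R →+ R) +
    (Finsupp.linearCombination R fun s =>
      Finsupp.linearCombination R (fun i => A i s) (b.repr x)).toAddMonoidHom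

section op

variable (A : I → Multiset I → (Multiset I →₀ R))

theorem op_apply (x : L) (v : Multiset I →₀ R) :
    op b A x v = Finsupp.mapRange.addMonoidHom (LieRingModule.toEnd L R x : R →+ R) v +
      Finsupp.linearCombination R (fun s =>
        Finsupp.linearCombination R (fun i => A i s) (b.repr x)) v := rfl

theorem op_smul (x : L) (r : R) (v : Multiset I →₀ R) :
    op b A x (r • v) = ⁅x, r⁆ • v + r • op b A x v := by
  have h : Finsupp.mapRange.addMonoidHom (LieRingModule.toEnd L R x : R →+ R) (r • v) =
      ⁅x, r⁆ • v + r • Finsupp.mapRange.addMonoidHom (LieRingModule.toEnd L R x : R →+ R) v := by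
    ext s
    simp [add_comm]
  rw [op_apply, op_apply, h, map_smul, smul_add, add_assoc]

theorem op_add_left (x y : L) (v : Multiset I →₀ R) :
    op b A (x + y) v = op b A x v + op b A y v := by
  refine finsupp_induction (P := fun v => op b A (x + y) v = op b A x v + op b A y v)
    (by simp) (fun v w hv hw => ?_) (fun r s => ?_) v
  · rw [map_add, hv, hw, map_add, map_add]; abel
  · rw [op_smul, op_smul, op_smul]
    simp only [op_apply, map_add, add_lie, add_smul, Finsupp.mapRange.addMonoidHom_apply,
      Finsupp.mapRange_single, Finsupp.linearCombination_single, one_smul, smul_add,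
      LieRingModule.toEnd_apply_apply, lie_one, AddMonoidHom.add_apply, Finsupp.single_zero,
      add_zero, smul_zero]
    abel

theorem op_smul_left (r : R) (x : L) (v : Multiset I →₀ R) :
    op b A (r • x) v = r • op b A x v := by
  refine finsupp_induction (P := fun v => op b A (r • x) v = r • op b A x v)
    (by simp) (fun v w hv hw => ?_) (fun r' s => ?_) v
  · rw [map_add, hv, hw, map_add, smul_add]
  · rw [op_smul, op_smul]
    simp only [op_apply, map_smul, LieRinehartRing.lie_smul_eq_mul,
      Finsupp.mapRange.addMonoidHom_apply, Finsupp.mapRange_single,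
      Finsupp.linearCombination_single, one_smul, smul_add,
      LieRingModule.toEnd_apply_apply, lie_one, Finsupp.single_zero,
      zero_add, mul_smul, smul_comm r r']

theorem op_zero_left (v : Multiset I →₀ R) : op b A 0 v = 0 := by
  rw [← zero_smul R (0 : L), op_smul_left, zero_smul]

theorem op_neg_left (x : L) (v : Multiset I →₀ R) : op b A (-x) v = - op b A x v := by
  rw [← neg_one_smul R x, op_smul_left, neg_one_smul]

theorem op_single (i : I) (s : Multiset I) : op b A (b i) (Finsupp.single s 1) = A i s := by
  rw [op_apply, Finsupp.mapRange.addMonoidHom_apply, Finsupp.mapRange_single]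
  simp [lie_one]

theorem op_mem {n m : ℕ} (hnm : n ≤ m)
    (hA : ∀ i s, Multiset.card s ≤ n → A i s ∈ degLE R I m) (x : L)
    (v : Multiset I →₀ R) (hv : v ∈ degLE R I n) : op b A x v ∈ degLE R I m := by
  refine degLE_induction (P := fun v => op b A x v ∈ degLE R I m) (by simp)
    (fun v w hv hw => by rw [map_add]; exact add_mem hv hw) (fun r s hs => ?_) v hv
  rw [op_smul]
  refine add_mem (Submodule.smul_mem _ _ (single_mem_degLE (hs.trans hnm) _))
    (Submodule.smul_mem _ _ ?_)
  rw [op_apply, Finsupp.mapRange.addMonoidHom_apply, Finsupp.mapRange_single,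
    Finsupp.linearCombination_single, one_smul]
  refine add_mem (single_mem_degLE (hs.trans hnm) _) ?_
  rw [Finsupp.linearCombination_apply]
  exact Submodule.sum_mem _ fun i _ => Submodule.smul_mem _ _ (hA i s hs)

/-- Only the values on monomials occurring in `v` matter. This is what lets successive truncated
actions be compared. -/
theorem op_congr {A' : I → Multiset I → (Multiset I →₀ R)} {n : ℕ}
    (hA : ∀ i s, Multiset.card s ≤ n → A i s = A' i s) (x : L)
    (v : Multiset I →₀ R) (hv : v ∈ degLE R I n) : op b A x v = op b A' x v := by
  refine degLE_induction (P := fun v => op b A x v = op b A' x v) (by simp)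
    (fun v w hv hw => by rw [map_add, map_add, hv, hw]) (fun r s hs => ?_) v hv
  rw [op_smul, op_smul, op_apply, op_apply, Finsupp.linearCombination_single,
    Finsupp.linearCombination_single]
  simp only [hA _ s hs]

end op

/-! ### Construction of the action by straightening monomials -/

variable [LinearOrder I]

/-- Successive approximations to the action of the basis elements on the monomials: the `n`-th one
is correct on monomials of degree at most `n`. -/
noncomputable def actAux : ℕ → I → Multiset I → (Multiset I →₀ R)
  -- Right for `s = 0`; in higher degrees a default, corrected where necessary at later stages.
  | 0, i, s => Finsupp.single (i ::ₘ s) 1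
  | n + 1, i, s =>
    match s.sort (· ≤ ·) with
    | [] => Finsupp.single (i ::ₘ s) 1
    | j :: l =>
      if i ≤ j then Finsupp.single (i ::ₘ s) 1
      -- Straightening: b_i b_j T should be b_j b_i T + [b_i, b_j] T. Write b_i T as the monomial iT
      -- plus lower terms; since j is least, b_j sends iT to the monomial ijT, so only the lower
      -- terms and the bracket need recursion.
      else Finsupp.single (i ::ₘ s) 1 +
        op b (actAux n) (b j) (actAux n i (l : Multiset I) - Finsupp.single (i ::ₘ (l : Multiset I)) 1) +
        op b (actAux n) ⁅b i, b j⁆ (Finsupp.single (l : Multiset I) 1)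

theorem sort_cons_of_le {j : I} {T : Multiset I} (h : ∀ t ∈ T, j ≤ t) :
    (j ::ₘ T).sort (· ≤ ·) = j :: T.sort (· ≤ ·) :=
  Multiset.sort_cons (r := (· ≤ ·)) j T h

theorem exists_eq_cons_of_le (s : Multiset I) (hs : s ≠ 0) :
    ∃ j T, s = j ::ₘ T ∧ ∀ t ∈ T, j ≤ t := by
  obtain ⟨j, hj, hmin⟩ := s.toFinset.exists_min_image id
    (by rwa [Finset.nonempty_iff_ne_empty, Ne, Multiset.toFinset_eq_empty])
  refine ⟨j, s.erase j, (Multiset.cons_erase (by simpa using hj)).symm, fun t ht => ?_⟩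
  exact hmin t (by simpa using Multiset.mem_of_mem_erase ht)

theorem actAux_of_le (n : ℕ) {i : I} {s : Multiset I} (h : ∀ t ∈ s, i ≤ t) :
    actAux b n i s = Finsupp.single (i ::ₘ s) 1 := by
  cases n with
  | zero => rfl
  | succ n =>
    rcases eq_or_ne s 0 with rfl | hs
    · simp [actAux]
    · obtain ⟨j, T, rfl, hT⟩ := exists_eq_cons_of_le s hs
      rw [actAux, sort_cons_of_le hT]
      simp [h j (Multiset.mem_cons_self j T)]

theorem actAux_succ_of_lt (n : ℕ) {i j : I} {T : Multiset I} (h : ∀ t ∈ T, j ≤ t) (hj : j < i) :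
    actAux b (n + 1) i (j ::ₘ T) = Finsupp.single (i ::ₘ j ::ₘ T) 1 +
      op b (actAux b n) (b j) (actAux b n i T - Finsupp.single (i ::ₘ T) 1) +
      op b (actAux b n) ⁅b i, b j⁆ (Finsupp.single T 1) := by
  rw [actAux, sort_cons_of_le h]
  simp [not_le.2 hj, Multiset.sort_eq]

/-- With s = j ::ₘ T, stage n + 1 applies the operators of stage n only to polynomials of degree at
most |T|, thanks to the bound on the correction term. There the induction hypothesis says that the
values no longer change. -/
theorem actAux_spec (n : ℕ) : ∀ (s : Multiset I), s.card ≤ n → ∀ i : I,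
    actAux b n i s - Finsupp.single (i ::ₘ s) 1 ∈ degLE R I s.card ∧
      ∀ m, n ≤ m → actAux b m i s = actAux b n i s := by
  induction n with
  | zero =>
    intro s hs i
    obtain rfl : s = 0 := by simpa using hs
    exact ⟨by simp [actAux], fun m _ => by
      rw [actAux_of_le b m (by simp), actAux_of_le b 0 (by simp)]⟩
  | succ n ih =>
    intro s hs i
    by_cases hi : ∀ t ∈ s, i ≤ t
    · exact ⟨by simp [actAux_of_le b _ hi], fun m _ => by
        rw [actAux_of_le b m hi, actAux_of_le b _ hi]⟩
    have hs0 : s ≠ 0 := by rintro rfl; exact hi (by simp)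
    obtain ⟨j, T, rfl, hT⟩ := exists_eq_cons_of_le s hs0
    have hj : j < i := by
      by_contra hij
      refine hi fun t ht => (not_lt.1 hij).trans ?_
      rcases Multiset.mem_cons.1 ht with rfl | ht
      exacts [le_rfl, hT t ht]
    have hTn : T.card ≤ n := by simpa using hs
    constructor
    · rw [actAux_succ_of_lt b n hT hj, add_assoc, add_sub_cancel_left, Multiset.card_cons]
      have hop : ∀ i s, Multiset.card s ≤ T.card → actAux b n i s ∈ degLE R I (T.card + 1) := by
        intro i' s' hs'
        have h := add_mem (degLE_mono (hs'.trans T.card.le_succ) (ih s' (hs'.trans hTn) i').1)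
          (single_mem_degLE (R := R) (n := T.card + 1) (s := i' ::ₘ s') (by simpa using hs') 1)
        rwa [sub_add_cancel] at h
      exact add_mem (op_mem b _ T.card.le_succ hop _ _ (ih T hTn i).1)
        (op_mem b _ T.card.le_succ hop _ _ (single_mem_degLE le_rfl _))
    · intro m hm
      obtain ⟨m, rfl⟩ := Nat.exists_eq_add_of_le' (Nat.one_le_of_lt hm)
      have hnm : n ≤ m := by omega
      rw [actAux_succ_of_lt b n hT hj, actAux_succ_of_lt b m hT hj, (ih T hTn i).2 m hnm]
      have hop : ∀ i s, Multiset.card s ≤ T.card → actAux b m i s = actAux b n i s :=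
        fun i' s' hs' => (ih s' (hs'.trans hTn) i').2 m hnm
      rw [op_congr b _ hop _ _ (ih T hTn i).1,
        op_congr b _ hop _ _ (single_mem_degLE le_rfl _)]

/-- The action of the basis element `b i` on the monomial `s`. -/
noncomputable def actMon (i : I) (s : Multiset I) : Multiset I →₀ R := actAux b s.card i s

/-- The action of `x : L` on polynomials in the basis elements. -/
noncomputable def act (x : L) : (Multiset I →₀ R) →+ (Multiset I →₀ R) := op b (actMon b) x

theorem act_smul (x : L) (r : R) (v : Multiset I →₀ R) :
    act b x (r • v) = ⁅x, r⁆ • v + r • act b x v := op_smul b _ x r v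

theorem act_add_left (x y : L) (v : Multiset I →₀ R) :
    act b (x + y) v = act b x v + act b y v := op_add_left b _ x y v

theorem act_smul_left (r : R) (x : L) (v : Multiset I →₀ R) :
    act b (r • x) v = r • act b x v := op_smul_left b _ r x v

theorem act_zero_left (v : Multiset I →₀ R) : act b 0 v = 0 := op_zero_left b _ v

theorem act_neg_left (x : L) (v : Multiset I →₀ R) : act b (-x) v = - act b x v :=
  op_neg_left b _ x v

theorem act_basis_of_le {i : I} {s : Multiset I} (h : ∀ t ∈ s, i ≤ t) :
    act b (b i) (Finsupp.single s 1) = Finsupp.single (i ::ₘ s) 1 := by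
  rw [act, op_single, actMon, actAux_of_le b _ h]

/-- To leading order a basis element acts by commutative multiplication; lower-degree remainders are
then handled by induction. -/
theorem act_basis_sub_mem (i : I) (s : Multiset I) :
    act b (b i) (Finsupp.single s 1) - Finsupp.single (i ::ₘ s) 1 ∈ degLE R I s.card := by
  rw [act, op_single, actMon]
  exact (actAux_spec b _ s le_rfl i).1

theorem act_mem {n : ℕ} (x : L) {v : Multiset I →₀ R} (hv : v ∈ degLE R I n) :
    act b x v ∈ degLE R I (n + 1) := by
  refine op_mem b _ n.le_succ (fun i s hs => ?_) x v hv
  have h := add_mem (degLE_mono (hs.trans n.le_succ) (act_basis_sub_mem b i s))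
    (single_mem_degLE (R := R) (n := n + 1) (s := i ::ₘ s) (by simpa using hs) 1)
  rwa [sub_add_cancel, act, op_single] at h

/-- The defining recursion freed of truncations: j is least in `i ::ₘ T`, so the leading monomial is
absorbed into the action of b_j. -/
theorem act_basis_cons_of_lt {i j : I} {T : Multiset I} (h : ∀ t ∈ T, j ≤ t) (hj : j < i) :
    act b (b i) (Finsupp.single (j ::ₘ T) 1) =
      act b (b j) (act b (b i) (Finsupp.single T 1)) + act b ⁅b i, b j⁆ (Finsupp.single T 1) := by
  have hop : ∀ i s, Multiset.card s ≤ T.card → actAux b T.card i s = actMon b i s :=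
    fun i' s' hs' => (actAux_spec b _ s' le_rfl i').2 _ hs'
  have h1 : act b (b i) (Finsupp.single (j ::ₘ T) 1) = Finsupp.single (i ::ₘ j ::ₘ T) 1 +
      act b (b j) (act b (b i) (Finsupp.single T 1) - Finsupp.single (i ::ₘ T) 1) +
      act b ⁅b i, b j⁆ (Finsupp.single T 1) := by
    have hmem := act_basis_sub_mem b i T
    have hT := op_congr b _ hop (b i) (Finsupp.single T 1) (single_mem_degLE le_rfl _)
    rw [op_single] at hT
    conv_lhs => rw [act, op_single, actMon, Multiset.card_cons, actAux_succ_of_lt b _ h hj, hT]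
    rw [op_congr b _ hop _ _ (single_mem_degLE le_rfl _), ← act,
      op_congr b _ hop _ _ hmem]
    rfl
  rw [h1, map_sub, act_basis_of_le b (i := j) (s := i ::ₘ T), Multiset.cons_swap]
  · abel
  · intro t ht
    rcases Multiset.mem_cons.1 ht with rfl | ht
    exacts [hj.le, h t ht]

/-! ### Compatibility of the action with brackets -/

/-- The failure of `act` to be compatible with brackets. -/
noncomputable def defect (x y : L) (v : Multiset I →₀ R) : Multiset I →₀ R :=
  act b x (act b y v) - act b y (act b x v) - act b ⁅x, y⁆ v

theorem defect_swap (x y : L) (v : Multiset I →₀ R) : defect b x y v = - defect b y x v := by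
  rw [defect, defect, ← lie_skew x y, act_neg_left]
  abel

theorem defect_add (x y : L) (v w : Multiset I →₀ R) :
    defect b x y (v + w) = defect b x y v + defect b x y w := by
  simp only [defect, map_add]; abel

/-- The derivative terms cancel because L acts on R by a Lie action. With `defect_smul_left` and
antisymmetry the defect is R-linear in every argument, so basis elements and monomials suffice. -/
theorem defect_smul (x y : L) (r : R) (v : Multiset I →₀ R) :
    defect b x y (r • v) = r • defect b x y v := by
  simp only [defect, act_smul, map_add, lie_lie, smul_sub, sub_smul]; abel

theorem defect_add_left (x x' y : L) (v : Multiset I →₀ R) :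
    defect b (x + x') y v = defect b x y v + defect b x' y v := by
  simp only [defect, act_add_left, map_add, add_lie]; abel

theorem defect_smul_left (r : R) (x y : L) (v : Multiset I →₀ R) :
    defect b (r • x) y v = r • defect b x y v := by
  have h : ⁅r • x, y⁆ = r • ⁅x, y⁆ + (-⁅y, r⁆) • x := by
    rw [← lie_skew, LieRinehartRing.leibniz_smul_right, ← lie_skew x y, neg_add, smul_neg, neg_smul]
  simp only [defect, h, act_smul_left, act_add_left, act_smul, smul_sub, neg_smul, act_neg_left]
  abel

theorem defect_eq_zero_of_basis (v : Multiset I →₀ R) (h : ∀ i j, defect b (b i) (b j) v = 0)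
    (x y : L) : defect b x y v = 0 := by
  have key : ∀ y : L, (∀ i, defect b (b i) y v = 0) → ∀ x, defect b x y v = 0 := by
    intro y hy x
    have hx : x ∈ Submodule.span R (Set.range b) := by rw [b.span_eq]; trivial
    induction hx using Submodule.span_induction with
    | mem x hx => obtain ⟨i, rfl⟩ := hx; exact hy i
    | zero => simpa using defect_smul_left b 0 0 y v
    | add x x' _ _ hx hx' => rw [defect_add_left, hx, hx', add_zero]
    | smul r x _ hx => rw [defect_smul_left, hx, smul_zero]
  refine key y (fun i => ?_) x
  rw [defect_swap, key (b i) (fun j => h j i) y, neg_zero]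

/-- For j < i this is the straightening rule. If i < j, then i also lies below every element of s,
and antisymmetry exchanges the roles. -/
theorem defect_eq_zero_of_le {i j : I} {s : Multiset I} (h : ∀ t ∈ s, j ≤ t) :
    defect b (b i) (b j) (Finsupp.single s 1) = 0 := by
  have key : ∀ {i j : I}, (∀ t ∈ s, j ≤ t) → j < i →
      defect b (b i) (b j) (Finsupp.single s 1) = 0 := fun {i j} h hj => by
    rw [defect, act_basis_of_le b h, act_basis_cons_of_lt b h hj]; abel
  rcases lt_trichotomy i j with hij | rfl | hij
  · rw [defect_swap, key (fun t ht => hij.le.trans (h t ht)) hij, neg_zero]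
  · simp [defect, act_zero_left]
  · exact key h hij

/-- Induction on degree. The remaining case is a monomial whose least element m is smaller than both
i and j: write it as b_m acting on a shorter monomial, move b_m to the front, and compare the two
orders by the Jacobi identity. -/
theorem defect_eq_zero_of_mem (n : ℕ) : ∀ v ∈ degLE R I n, ∀ x y : L, defect b x y v = 0 := by
  induction n with
  | zero =>
    refine degLE_induction (fun x y => by simp [defect])
      (fun v w hv hw x y => by rw [defect_add, hv, hw, add_zero]) (fun r s hs x y => ?_)
    obtain rfl : s = 0 := by simpa using hs
    rw [defect_smul, defect_eq_zero_of_basis b _ (fun i j => defect_eq_zero_of_le b (by simp)),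
      smul_zero]
  | succ n ih =>
    refine degLE_induction (fun x y => by simp [defect])
      (fun v w hv hw x y => by rw [defect_add, hv, hw, add_zero]) (fun r s hs x y => ?_)
    rw [defect_smul, defect_eq_zero_of_basis b _ (fun i j => ?_), smul_zero]
    by_cases hj : ∀ t ∈ s, j ≤ t
    · exact defect_eq_zero_of_le b hj
    by_cases hi : ∀ t ∈ s, i ≤ t
    · rw [defect_swap, defect_eq_zero_of_le b hi, neg_zero]
    obtain ⟨m, T, rfl, hT⟩ := exists_eq_cons_of_le s (by rintro rfl; exact hi (by simp))
    have hlt : ∀ i : I, (¬ ∀ t ∈ m ::ₘ T, i ≤ t) → m < i := by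
      intro i hi
      by_contra hmi
      refine hi fun t ht => (not_lt.1 hmi).trans ?_
      rcases Multiset.mem_cons.1 ht with rfl | ht
      exacts [le_rfl, hT t ht]
    have hTn : T.card ≤ n := by simpa using hs
    set u : Multiset I →₀ R := Finsupp.single T 1 with hu
    have hun : u ∈ degLE R I n := single_mem_degLE hTn _
    have comm : ∀ x y : L, act b x (act b y u) = act b y (act b x u) + act b ⁅x, y⁆ u := by
      intro x y
      rw [← sub_eq_zero, ← sub_sub]; exact ih u hun x y
    -- Here the argument b_j u may have degree n + 1. Its lower part is covered by induction, and
    -- its leading monomial `j ::ₘ T` has no element below m.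
    have comm' : ∀ i j : I, m < i → m < j → act b (b i) (act b (b m) (act b (b j) u)) =
        act b (b m) (act b (b i) (act b (b j) u)) + act b ⁅b i, b m⁆ (act b (b j) u) := by
      intro i j _ hj
      rw [← sub_eq_zero, ← sub_sub]
      change defect b (b i) (b m) _ = 0
      rw [← sub_add_cancel (act b (b j) u) (Finsupp.single (j ::ₘ T) 1), defect_add,
        ih _ (degLE_mono hTn (act_basis_sub_mem b j T)), zero_add]
      refine defect_eq_zero_of_le b fun t ht => ?_
      rcases Multiset.mem_cons.1 ht with rfl | ht
      exacts [hj.le, hT t ht]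
    have main : ∀ i j : I, m < i → m < j → act b (b i) (act b (b j) (act b (b m) u)) =
        act b (b m) (act b (b i) (act b (b j) u)) + act b ⁅b i, b m⁆ (act b (b j) u) +
          act b ⁅b j, b m⁆ (act b (b i) u) + act b ⁅b i, ⁅b j, b m⁆⁆ u := by
      intro i j hi hj
      rw [comm (b j) (b m), map_add, comm' i j hi hj, comm (b i) ⁅b j, b m⁆]
      abel
    -- In the difference of the two expansions the mixed terms cancel. What is left is b_m [b_i,
    -- b_j] u and the two triple brackets, which Jacobi combines into [[b_i, b_j], b_m] u.
    rw [← act_basis_of_le b hT, ← hu, defect, main i j (hlt i hi) (hlt j hj),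
      main j i (hlt j hj) (hlt i hi), comm ⁅b i, b j⁆ (b m), comm (b i) (b j), lie_lie (b i) (b j),
      sub_eq_add_neg ⁅b i, ⁅b j, b m⁆⁆, act_add_left, act_neg_left, map_add]
    abel

theorem act_lie (x y : L) (v : Multiset I →₀ R) :
    act b ⁅x, y⁆ v = act b x (act b y v) - act b y (act b x v) := by
  have h : defect b x y v = 0 :=
    defect_eq_zero_of_mem b (v.support.sup Multiset.card) v
      (fun s hs => Finset.le_sup (f := Multiset.card) hs) x y
  exact (sub_eq_zero.1 h).symm

/-! ### Evaluation of polynomials in an arbitrary module -/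

section universal

variable {W : Type*} [AddCommGroup W] [Module R W] (η : L → W →+ W)

/-- The linear map from polynomials to an `L`-module `W` which sends an ordered monomial to the
value of the corresponding product of basis elements on `w`. -/
noncomputable def eval (w : W) : (Multiset I →₀ R) →ₗ[R] W :=
  Finsupp.linearCombination R fun s => (s.sort (· ≤ ·)).foldr (fun i w => η (b i) w) w

theorem eval_single_zero (w : W) : eval b η w (Finsupp.single 0 1) = w := by
  simp [eval]

theorem eval_single_cons (w : W) {j : I} {T : Multiset I} (h : ∀ t ∈ T, j ≤ t) :
    eval b η w (Finsupp.single (j ::ₘ T) 1) = η (b j) (eval b η w (Finsupp.single T 1)) := by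
  simp [eval, sort_cons_of_le h]

/-- The straightening rule defining the action is an identity in every module `W` satisfying the
hypotheses, so the same induction on degree shows that evaluation intertwines the two actions. -/
theorem eval_act (hadd : ∀ x y w, η (x + y) w = η x w + η y w)
    (hsmul : ∀ (r : R) x w, η (r • x) w = r • η x w)
    (hleib : ∀ x (r : R) w, η x (r • w) = ⁅x, r⁆ • w + r • η x w)
    (hlie : ∀ x y w, η ⁅x, y⁆ w = η x (η y w) - η y (η x w))
    (w : W) (x : L) (v : Multiset I →₀ R) : eval b η w (act b x v) = η x (eval b η w v) := by
  have ext_basis : ∀ v : Multiset I →₀ R,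
      (∀ i, eval b η w (act b (b i) v) = η (b i) (eval b η w v)) →
      ∀ x, eval b η w (act b x v) = η x (eval b η w v) := by
    intro v hv x
    have hx : x ∈ Submodule.span R (Set.range b) := by rw [b.span_eq]; trivial
    induction hx using Submodule.span_induction with
    | mem x hx => obtain ⟨i, rfl⟩ := hx; exact hv i
    | zero => rw [act_zero_left, map_zero, ← zero_smul R (0 : L), hsmul, zero_smul]
    | add x x' _ _ hx hx' => rw [act_add_left, map_add, hx, hx', hadd]
    | smul r x _ hx => rw [act_smul_left, map_smul, hx, hsmul]
  have ext_deg : ∀ n, (∀ (s : Multiset I), s.card ≤ n → ∀ i,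
      eval b η w (act b (b i) (Finsupp.single s 1)) =
        η (b i) (eval b η w (Finsupp.single s 1))) →
      ∀ v ∈ degLE R I n, ∀ x, eval b η w (act b x v) = η x (eval b η w v) := by
    intro n hn
    refine degLE_induction (fun x => by simp) (fun v v' hv hv' x => by
      simp only [map_add, hv, hv']) fun r s hs x => ?_
    rw [act_smul, map_add, map_smul, map_smul, map_smul, hleib, ext_basis _ (hn s hs)]
  have key : ∀ n, ∀ (s : Multiset I), s.card ≤ n → ∀ i,
      eval b η w (act b (b i) (Finsupp.single s 1)) =
        η (b i) (eval b η w (Finsupp.single s 1)) := by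
    intro n
    induction n with
    | zero =>
      intro s hs i
      obtain rfl : s = 0 := by simpa using hs
      rw [act_basis_of_le b (by simp), eval_single_cons b η w (by simp)]
    | succ n ih =>
      intro s hs i
      by_cases hi : ∀ t ∈ s, i ≤ t
      · rw [act_basis_of_le b hi, eval_single_cons b η w hi]
      obtain ⟨j, T, rfl, hT⟩ := exists_eq_cons_of_le s (by rintro rfl; exact hi (by simp))
      have hj : j < i := by
        by_contra hij
        refine hi fun t ht => (not_lt.1 hij).trans ?_
        rcases Multiset.mem_cons.1 ht with rfl | ht
        exacts [le_rfl, hT t ht]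
      have hTn : T.card ≤ n := by simpa using hs
      have hu : (Finsupp.single T 1 : Multiset I →₀ R) ∈ degLE R I n := single_mem_degLE hTn _
      have hle : ∀ t ∈ i ::ₘ T, j ≤ t := fun t ht => by
        rcases Multiset.mem_cons.1 ht with rfl | ht
        exacts [hj.le, hT t ht]
      -- Split off the leading monomial: j is least in `i ::ₘ T`, so evaluation handles it by
      -- definition, while the remainder has degree at most n.
      have hji : eval b η w (act b (b j) (act b (b i) (Finsupp.single T 1))) =
          η (b j) (eval b η w (act b (b i) (Finsupp.single T 1))) := by
        rw [← sub_add_cancel (act b (b i) (Finsupp.single T 1)) (Finsupp.single (i ::ₘ T) 1)]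
        rw [map_add, map_add, map_add, map_add, act_basis_of_le b hle, eval_single_cons b η w hle,
          ext_deg n ih _ (degLE_mono hTn (act_basis_sub_mem b i T))]
      rw [act_basis_cons_of_lt b hT hj, map_add, hji, ih T hTn, ext_deg n ih _ hu,
        eval_single_cons b η w hT, hlie]
      abel
  exact ext_deg _ (key _) v (fun s hs => Finset.le_sup (f := Multiset.card) hs) x

end universal

end LieRinehartPBW

/-! ### The Eilenberg swindle -/

section swindle

variable {R : Type*} [Ring R] {P Q : Type*} [AddCommGroup P] [Module R P] [AddCommGroup Q]
  [Module R Q]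

/-- Finitely supported functions with values in a product. -/
noncomputable def Finsupp.prodValuesLEquiv (R P Q ι : Type*) [Ring R] [AddCommGroup P]
    [Module R P] [AddCommGroup Q] [Module R Q] :
    (ι →₀ P × Q) ≃ₗ[R] (ι →₀ P) × (ι →₀ Q) :=
  LinearEquiv.ofLinearMap
    ((Finsupp.mapRange.linearMap (LinearMap.fst R P Q)).prod
      (Finsupp.mapRange.linearMap (LinearMap.snd R P Q)))
    ((Finsupp.mapRange.linearMap (LinearMap.inl R P Q)).coprod
      (Finsupp.mapRange.linearMap (LinearMap.inr R P Q)))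
    (by ext <;> simp)
    (by ext <;> simp)

/-- Infinitely many copies of `P` absorb one more copy. -/
noncomputable def prodFinsuppNatLEquiv : (P × (ℕ →₀ P)) ≃ₗ[R] (ℕ →₀ P) :=
  ((LinearEquiv.prodCongr (Finsupp.uniqueLinearEquiv R P ()).symm
    (LinearEquiv.refl R (ℕ →₀ P))).trans (Finsupp.sumFinsuppLEquivProdFinsupp R).symm).trans
    (Finsupp.domLCongr ((Equiv.sumComm Unit ℕ).trans Equiv.natSumPUnitEquivNat))

/-- The Eilenberg swindle: a countably generated projective module is absorbed by a free module
of countably infinite rank. -/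
theorem Module.Projective.exists_prod_finsupp_equiv [Module.Projective R P]
    (f : (ℕ →₀ R) →ₗ[R] P) (hf : Function.Surjective f) :
    Nonempty ((P × (ℕ →₀ R)) ≃ₗ[R] (ℕ →₀ R)) := by
  obtain ⟨s, hs⟩ := f.exists_rightInverse_of_surjective (LinearMap.range_eq_top.2 hf)
  have hs' : ∀ p, f (s p) = p := fun p => LinearMap.congr_fun hs p
  let e : (ℕ →₀ R) ≃ₗ[R] P × LinearMap.ker f :=
    LinearEquiv.ofLinearMap
      (f.prod ((LinearMap.id - s ∘ₗ f).codRestrict (LinearMap.ker f) (fun x => by simp [hs'])))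
      (s.coprod (LinearMap.ker f).subtype)
      (by
        ext x
        · simp [hs']
        · simp [hs']
        · simp
        · simp [LinearMap.mem_ker.1 x.2])
      (by ext; simp)
  -- Since ℕ ≃ ℕ × ℕ, the free module is a countable sum of copies of itself, hence P^(ℕ) ⊕ K^(ℕ)
  -- with K the kernel; the first summand absorbs one more P.
  let e₁ : (ℕ →₀ R) ≃ₗ[R] (ℕ →₀ P) × (ℕ →₀ LinearMap.ker f) :=
    (((Finsupp.domLCongr Nat.pairEquiv.symm).trans (Finsupp.curryLinearEquiv R)).trans
      (Finsupp.mapRange.linearEquiv e)).trans (Finsupp.prodValuesLEquiv R P (LinearMap.ker f) ℕ)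
  exact ⟨(((LinearEquiv.refl R P).prodCongr e₁).trans
    ((LinearEquiv.prodAssoc R P (ℕ →₀ P) (ℕ →₀ LinearMap.ker f)).symm.trans
      (prodFinsuppNatLEquiv.prodCongr (LinearEquiv.refl R _)))).trans e₁.symm⟩

/-- A countably generated projective module which maps onto a free module of countably infinite
rank is free. -/
theorem Module.Projective.free_of_surjective [Module.Projective R P]
    (f : (ℕ →₀ R) →ₗ[R] P) (hf : Function.Surjective f)
    (g : P →ₗ[R] (ℕ →₀ R)) (hg : Function.Surjective g) : Module.Free R P := by
  obtain ⟨s, hs⟩ := g.exists_rightInverse_of_surjective (LinearMap.range_eq_top.2 hg)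
  have hs' : ∀ p, g (s p) = p := fun p => LinearMap.congr_fun hs p
  let p : P →ₗ[R] LinearMap.ker g :=
    (LinearMap.id - s ∘ₗ g).codRestrict (LinearMap.ker g) (fun x => by simp [hs'])
  have hp : ∀ x : LinearMap.ker g, p x = x := fun x => by
    ext; simp [p, LinearMap.mem_ker.1 x.2]
  let e : P ≃ₗ[R] LinearMap.ker g × (ℕ →₀ R) :=
    LinearEquiv.ofLinearMap (p.prod g) ((LinearMap.ker g).subtype.coprod s)
      (by
        ext x
        · simp [hp]
        · simp [LinearMap.mem_ker.1 x.2]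
        · simp [p, hs']
        · simp [hs'])
      (by ext; simp [p])
  -- P is ker g ⊕ R^(ℕ), and ker g is again projective and countably generated, so the free summand
  -- absorbs it.
  have : Module.Projective R (LinearMap.ker g) :=
    Module.Projective.of_split (LinearMap.ker g).subtype p (by ext x; simp [hp])
  obtain ⟨e'⟩ := Module.Projective.exists_prod_finsupp_equiv (p ∘ₗ f)
    (Function.Surjective.comp (g := p) (fun x => ⟨x.1, hp x⟩) hf)
  exact Module.Free.of_equiv (e.trans e').symm

end swindle

/-! ### The Lie–Rinehart structure on the Kähler differentials of a Poisson algebra -/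

section twist

variable {k : Type*} {Z : Type*} [Field k] [CommRing Z] [Algebra k Z]

/-- The module `Ω × Ω` with the scalar multiplication twisted by a derivation: linear maps into it
with identity first component are derivative-like operators on `Ω`. -/
def DerivationTwist (_ : Derivation k Z Z) : Type _ := Ω[Z⁄k] × Ω[Z⁄k]

variable (D : Derivation k Z Z)

noncomputable instance : AddCommGroup (DerivationTwist D) := inferInstanceAs (AddCommGroup (Ω[Z⁄k] × Ω[Z⁄k]))

noncomputable instance : Module k (DerivationTwist D) := inferInstanceAs (Module k (Ω[Z⁄k] × Ω[Z⁄k]))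

noncomputable instance : Module Z (DerivationTwist D) where
  smul r m := (r • m.1, r • m.2 + D r • m.1)
  one_smul m := Prod.ext (one_smul _ _) (by change (1 : Z) • m.2 + D 1 • m.1 = _; simp)
  mul_smul r s m := Prod.ext (mul_smul _ _ _) (by
    change (r * s) • m.2 + D (r * s) • m.1 = r • (s • m.2 + D s • m.1) + D r • s • m.1
    rw [D.leibniz]
    simp only [smul_add, add_smul, smul_smul, smul_eq_mul, mul_comm s]
    abel)
  smul_zero r := Prod.ext (smul_zero _) (by
    change r • (0 : Ω[Z⁄k]) + D r • (0 : Ω[Z⁄k]) = 0; simp)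
  smul_add r m m' := Prod.ext (smul_add _ _ _) (by
    change r • (m.2 + m'.2) + D r • (m.1 + m'.1) = r • m.2 + D r • m.1 + (r • m'.2 + D r • m'.1)
    simp only [smul_add]; abel)
  add_smul r r' m := Prod.ext (add_smul _ _ _) (by
    change (r + r') • m.2 + D (r + r') • m.1 = r • m.2 + D r • m.1 + (r' • m.2 + D r' • m.1)
    simp only [map_add, add_smul]; abel)
  zero_smul m := Prod.ext (zero_smul _ _) (by change (0 : Z) • m.2 + D 0 • m.1 = 0; simp)

instance : IsScalarTower k Z (DerivationTwist D) :=
  IsScalarTower.of_algebraMap_smul fun c m => Prod.ext (algebraMap_smul Z c m.1) (by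
    change algebraMap k Z c • m.2 + D (algebraMap k Z c) • m.1 = c • m.2
    simp)

variable {D}

/-- The operator `ℒ` on Kähler differentials with `ℒ (r d x) = r (T x) + (D r) d x`. -/
noncomputable def kaehlerOperator (D : Derivation k Z Z) (T : Z →ₗ[k] Ω[Z⁄k])
    (hT : ∀ x y, T (x * y) = x • T y + y • T x + D x • KaehlerDifferential.D k Z y +
      D y • KaehlerDifferential.D k Z x) : Ω[Z⁄k] →ₗ[Z] DerivationTwist D :=
  -- `hT` is exactly the Leibniz rule for x ↦ (dx, T x) in the twisted module, so the universal
  -- property of Ω produces an operator that is not Z-linear.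
  Derivation.liftKaehlerDifferential (M := DerivationTwist D) (Derivation.mk'
    { toFun := fun x => ((KaehlerDifferential.D k Z x, T x) : Ω[Z⁄k] × Ω[Z⁄k])
      map_add' := fun x y => Prod.ext (map_add _ x y) (map_add T x y)
      map_smul' := fun c x => Prod.ext (Derivation.map_smul _ c x)
        (map_smul T c x) }
    (fun x y => Prod.ext ((KaehlerDifferential.D k Z).leibniz x y) (by
      change T (x * y) = x • T y + D x • KaehlerDifferential.D k Z y +
        (y • T x + D y • KaehlerDifferential.D k Z x)
      rw [hT]; abel)))

theorem kaehler_induction {P : Ω[Z⁄k] → Prop} (D : ∀ x, P (KaehlerDifferential.D k Z x))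
    (add : ∀ ω η, P ω → P η → P (ω + η)) (smul : ∀ (r : Z) ω, P ω → P (r • ω)) (ω : Ω[Z⁄k]) :
    P ω := by
  have h : ω ∈ Submodule.span Z (Set.range (KaehlerDifferential.D k Z)) := by
    rw [KaehlerDifferential.span_range_derivation]; trivial
  induction h using Submodule.span_induction with
  | mem x hx => obtain ⟨x, rfl⟩ := hx; exact D x
  | zero => simpa using smul 0 _ (D 0)
  | add x y _ _ hx hy => exact add x y hx hy
  | smul r x _ hx => exact smul r x hx

variable (T : Z →ₗ[k] Ω[Z⁄k])
    (hT : ∀ x y, T (x * y) = x • T y + y • T x + D x • KaehlerDifferential.D k Z y +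
      D y • KaehlerDifferential.D k Z x)

theorem kaehlerOperator_D (x : Z) :
    kaehlerOperator D T hT (KaehlerDifferential.D k Z x) = (KaehlerDifferential.D k Z x, T x) :=
  Derivation.liftKaehlerDifferential_comp_D _ _

theorem kaehlerOperator_fst (ω : Ω[Z⁄k]) : Prod.fst (kaehlerOperator D T hT ω : Ω[Z⁄k] × Ω[Z⁄k]) = ω := by
  induction ω using kaehler_induction with
  | D x =>
    rw [kaehlerOperator_D]
  | add ω η h h' =>
    rw [map_add]; exact congrArg₂ (· + ·) h h'
  | smul r ω h =>
    rw [map_smul]; exact congrArg (r • ·) h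

/-- The second component of `kaehlerOperator`. -/
noncomputable def kaehlerOp (D : Derivation k Z Z) (T : Z →ₗ[k] Ω[Z⁄k])
    (hT : ∀ x y, T (x * y) = x • T y + y • T x + D x • KaehlerDifferential.D k Z y +
      D y • KaehlerDifferential.D k Z x) : Ω[Z⁄k] →+ Ω[Z⁄k] :=
  (AddMonoidHom.snd Ω[Z⁄k] Ω[Z⁄k]).comp (kaehlerOperator D T hT).toAddMonoidHom

theorem kaehlerOp_D (x : Z) : kaehlerOp D T hT (KaehlerDifferential.D k Z x) = T x :=
  congrArg Prod.snd (kaehlerOperator_D T hT x)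

theorem kaehlerOp_smul (r : Z) (ω : Ω[Z⁄k]) :
    kaehlerOp D T hT (r • ω) = r • kaehlerOp D T hT ω + D r • ω := by
  have h := congrArg Prod.snd (map_smul (kaehlerOperator D T hT) r ω)
  refine h.trans ?_
  change r • (Prod.snd (kaehlerOperator D T hT ω : Ω[Z⁄k] × Ω[Z⁄k])) + D r • (Prod.fst (kaehlerOperator D T hT ω : Ω[Z⁄k] × Ω[Z⁄k])) = _
  rw [kaehlerOperator_fst]
  rfl

end twist

namespace PoissonAlgebra

variable {k : Type*} {Z : Type*} [Field k] [CommRing Z] [Algebra k Z] [PoissonAlgebra k Z]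

local notation "δ" => KaehlerDifferential.D k Z

/-- The Hamiltonian derivations. -/
noncomputable def hamDerivation : Derivation k Z (Derivation k Z Z) :=
  Derivation.mk'
    { toFun := fun z => Derivation.mk' (bracket (k := k) z) (fun x y => by
        rw [leibniz]; simp only [smul_eq_mul]; ring)
      map_add' := fun x y => by ext; simp
      map_smul' := fun c x => by ext; simp }
    (fun x y => by
      ext z
      change bracket (k := k) (x * y) z = x * bracket (k := k) y z + y * bracket (k := k) x z
      rw [bracket_swap (x * y), leibniz, bracket_swap z, bracket_swap z]; ring)

theorem hamDerivation_apply (x y : Z) :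
    hamDerivation (k := k) x y = bracket (k := k) x y := rfl

variable (k Z) in
/-- The anchor `r d x ↦ r {x, -}`. -/
noncomputable def anchor : Ω[Z⁄k] →ₗ[Z] Derivation k Z Z :=
  (hamDerivation (k := k) (Z := Z)).liftKaehlerDifferential

theorem anchor_D (x y : Z) : anchor k Z (δ x) y = bracket (k := k) x y := by
  rw [anchor, Derivation.liftKaehlerDifferential_comp_D, hamDerivation_apply]

/-- The Lie derivative of differentials along a Hamiltonian derivation. -/
noncomputable def lieDer (z : Z) : Ω[Z⁄k] →+ Ω[Z⁄k] :=
  kaehlerOp (hamDerivation z) ((δ).toLinearMap ∘ₗ bracket (k := k) z) (fun x y => by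
    simp only [LinearMap.comp_apply, leibniz, hamDerivation_apply, Derivation.coeFn_coe, map_add,
      Derivation.leibniz]
    abel)

theorem lieDer_D (z x : Z) : lieDer z (δ x) = δ (bracket (k := k) z x) := kaehlerOp_D _ _ x

theorem lieDer_smul (z r : Z) (ω : Ω[Z⁄k]) :
    lieDer z (r • ω) = r • lieDer z ω + bracket (k := k) z r • ω := kaehlerOp_smul _ _ r ω

theorem lieDer_add_left (z z' : Z) (ω : Ω[Z⁄k]) :
    lieDer (z + z') ω = lieDer z ω + lieDer z' ω := by
  induction ω using kaehler_induction with
  | D x =>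
    simp [lieDer_D]
  | add ω η h h' =>
    rw [map_add, map_add, map_add, h, h']; abel
  | smul r ω h =>
    simp only [lieDer_smul, h, map_add, LinearMap.add_apply, add_smul, smul_add]; abel

theorem lieDer_smul_left (c : k) (z : Z) (ω : Ω[Z⁄k]) :
    lieDer (c • z) ω = c • lieDer z ω := by
  induction ω using kaehler_induction with
  | D x =>
    simp [lieDer_D]
  | add ω η h h' =>
    rw [map_add, map_add, h, h', smul_add]
  | smul r ω h =>
    simp only [lieDer_smul, h, map_smul, LinearMap.smul_apply, smul_add, smul_assoc,
      smul_comm r c]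

/-- The failure of z ↦ `lieDer z ω` to be a derivation is, after a change of sign, the correction
that `kaehlerOp` requires for building `kaehlerBracket`. -/
theorem lieDer_mul (x y : Z) (ω : Ω[Z⁄k]) : lieDer (x * y) ω =
    x • lieDer y ω + y • lieDer x ω - anchor k Z ω x • δ y - anchor k Z ω y • δ x := by
  have hb : ∀ z, bracket (k := k) (x * y) z = x * bracket (k := k) y z + y * bracket (k := k) x z :=
    fun z => by rw [bracket_swap (x * y), leibniz, bracket_swap z, bracket_swap z]; ring
  induction ω using kaehler_induction with
  | D z =>
    simp only [lieDer_D, anchor_D, hb, map_add, Derivation.leibniz, bracket_swap z, neg_smul]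
    abel
  | add ω η h h' =>
    simp only [map_add, h, h', Derivation.add_apply, add_smul, smul_add]
    abel
  | smul r ω h =>
    simp only [lieDer_smul, h, hb, map_smul, Derivation.smul_apply, smul_eq_mul, mul_smul,
      add_smul, smul_add, smul_sub, smul_comm r]
    abel

/-- The Lie bracket of Kähler differentials, with `[d x, d y] = d {x, y}`. -/
noncomputable def kaehlerBracket (ω : Ω[Z⁄k]) : Ω[Z⁄k] →+ Ω[Z⁄k] :=
  kaehlerOp (anchor k Z ω)
    { toFun := fun y => - lieDer y ω
      map_add' := fun x y => by rw [lieDer_add_left]; abel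
      map_smul' := fun c x => by rw [lieDer_smul_left]; simp }
    (fun x y => by
      simp only [LinearMap.coe_mk, AddHom.coe_mk, lieDer_mul, smul_neg]
      abel)

theorem kaehlerBracket_D (ω : Ω[Z⁄k]) (y : Z) : kaehlerBracket ω (δ y) = - lieDer y ω :=
  kaehlerOp_D _ _ y

theorem kaehlerBracket_D_D (x y : Z) :
    kaehlerBracket (δ x) (δ y) = δ (bracket (k := k) x y) := by
  rw [kaehlerBracket_D, lieDer_D, bracket_swap, map_neg, neg_neg]

theorem kaehlerBracket_smul (ω : Ω[Z⁄k]) (r : Z) (η : Ω[Z⁄k]) :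
    kaehlerBracket ω (r • η) = r • kaehlerBracket ω η + anchor k Z ω r • η :=
  kaehlerOp_smul _ _ r η

theorem kaehlerBracket_add_left (ω ω' η : Ω[Z⁄k]) :
    kaehlerBracket (ω + ω') η = kaehlerBracket ω η + kaehlerBracket ω' η := by
  induction η using kaehler_induction with
  | D x =>
    simp only [kaehlerBracket_D, map_add]; abel
  | add η η' h h' =>
    simp only [map_add, h, h']; abel
  | smul r η h =>
    simp only [kaehlerBracket_smul, h, map_add, Derivation.add_apply, add_smul, smul_add]; abel

theorem kaehlerBracket_smul_left (r : Z) (ω η : Ω[Z⁄k]) :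
    kaehlerBracket (r • ω) η = r • kaehlerBracket ω η - anchor k Z η r • ω := by
  induction η using kaehler_induction with
  | D x =>
    simp only [kaehlerBracket_D, lieDer_smul, anchor_D, smul_neg]; abel
  | add η η' h h' =>
    simp only [map_add, h, h', Derivation.add_apply, add_smul, smul_add]; abel
  | smul s η h =>
    simp only [kaehlerBracket_smul, h, map_smul, Derivation.smul_apply, smul_eq_mul, mul_smul,
      smul_add, smul_sub, smul_comm r]; abel

theorem kaehlerBracket_D_left (x : Z) (ω : Ω[Z⁄k]) : kaehlerBracket (δ x) ω = lieDer x ω := by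
  induction ω using kaehler_induction with
  | D y =>
    rw [kaehlerBracket_D_D, lieDer_D]
  | add η η' h h' =>
    simp only [map_add, h, h']
  | smul s η h =>
    simp only [kaehlerBracket_smul, lieDer_smul, h, anchor_D]

theorem kaehlerBracket_swap (ω η : Ω[Z⁄k]) : kaehlerBracket ω η = - kaehlerBracket η ω := by
  induction η using kaehler_induction with
  | D x =>
    rw [kaehlerBracket_D, kaehlerBracket_D_left]
  | add η η' h h' =>
    rw [map_add, h, h', kaehlerBracket_add_left]; abel
  | smul r η h =>
    rw [kaehlerBracket_smul, kaehlerBracket_smul_left, h, smul_neg]; abel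

theorem kaehlerBracket_self (ω : Ω[Z⁄k]) : kaehlerBracket ω ω = 0 := by
  induction ω using kaehler_induction with
  | D x =>
    rw [kaehlerBracket_D_D, bracket_self, map_zero]
  | add η η' h h' =>
    rw [kaehlerBracket_add_left, map_add, map_add, h, h', kaehlerBracket_swap η]; abel
  | smul r η h =>
    rw [kaehlerBracket_smul, kaehlerBracket_smul_left, h, map_smul]
    simp [mul_smul]

/-- On exact differentials this is the Jacobi identity of Z, and both sides have the same correction
terms under scaling. -/
theorem anchor_kaehlerBracket (ω η : Ω[Z⁄k]) (r : Z) : anchor k Z (kaehlerBracket ω η) r =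
    anchor k Z ω (anchor k Z η r) - anchor k Z η (anchor k Z ω r) := by
  induction η using kaehler_induction with
  | D x =>
    induction ω using kaehler_induction with
    | D y =>
      rw [kaehlerBracket_D_D]; simp only [anchor_D, jacobi]
    | add η η' h h' =>
      simp only [kaehlerBracket_add_left, map_add, Derivation.add_apply, h, h']; abel
    | smul s η h =>
      simp only [kaehlerBracket_smul_left, map_sub, map_smul, Derivation.sub_apply,
        Derivation.smul_apply, h, smul_eq_mul, Derivation.leibniz]; ring
  | add η η' h h' =>
    simp only [map_add, Derivation.add_apply, h, h']; abel
  | smul s η h =>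
    simp only [kaehlerBracket_smul, map_add, map_smul, Derivation.add_apply,
      Derivation.smul_apply, h, smul_eq_mul, Derivation.leibniz]; ring

/-- The Jacobiator is Z-linear in each argument since the anchor respects brackets, which reduces to
exact differentials. `ext_left` treats the first argument, and `swap` brings the second into its
place. -/
theorem kaehlerBracket_jacobi (ω η θ : Ω[Z⁄k]) : kaehlerBracket ω (kaehlerBracket η θ) =
    kaehlerBracket (kaehlerBracket ω η) θ + kaehlerBracket η (kaehlerBracket ω θ) := by
  have swap : ∀ {ω η θ : Ω[Z⁄k]}, kaehlerBracket ω (kaehlerBracket η θ) =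
      kaehlerBracket (kaehlerBracket ω η) θ + kaehlerBracket η (kaehlerBracket ω θ) →
      kaehlerBracket η (kaehlerBracket ω θ) =
      kaehlerBracket (kaehlerBracket η ω) θ + kaehlerBracket ω (kaehlerBracket η θ) := by
    intro ω η θ h
    have hn : kaehlerBracket (kaehlerBracket η ω) θ = - kaehlerBracket (kaehlerBracket ω η) θ := by
      rw [kaehlerBracket_swap η ω, kaehlerBracket_swap _ θ, map_neg, ← kaehlerBracket_swap]
    rw [h, hn]; abel
  have ext_left : ∀ η θ : Ω[Z⁄k], (∀ x, kaehlerBracket (δ x) (kaehlerBracket η θ) =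
      kaehlerBracket (kaehlerBracket (δ x) η) θ + kaehlerBracket η (kaehlerBracket (δ x) θ)) →
      ∀ ω, kaehlerBracket ω (kaehlerBracket η θ) =
      kaehlerBracket (kaehlerBracket ω η) θ + kaehlerBracket η (kaehlerBracket ω θ) := by
    intro η θ h ω
    induction ω using kaehler_induction with
    | D x => exact h x
    | add ω ω' h h' =>
      simp only [kaehlerBracket_add_left, map_add, h, h']; abel
    | smul s ω h =>
      simp only [kaehlerBracket_smul_left, h, sub_eq_add_neg, kaehlerBracket_add_left, map_add,
        ← neg_smul, kaehlerBracket_smul, anchor_kaehlerBracket, smul_add, map_neg, neg_add, neg_neg,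
        add_smul, kaehlerBracket_swap η ω, smul_neg]
      simp only [neg_smul]
      abel
  induction θ using kaehler_induction with
  | D z =>
    refine ext_left _ _ (fun x => swap (ext_left _ _ (fun y => ?_) η)) ω
    simp only [kaehlerBracket_D_D, jacobi, map_sub]; abel
  | add θ θ' h h' =>
    simp only [map_add, h, h']; abel
  | smul s θ h =>
    simp only [kaehlerBracket_smul, map_add, h, anchor_kaehlerBracket, smul_add, sub_smul]
    abel

noncomputable instance : LieRing Ω[Z⁄k] where
  bracket ω η := kaehlerBracket ω η
  add_lie := kaehlerBracket_add_left
  lie_add _ := map_add _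
  lie_self := kaehlerBracket_self
  leibniz_lie := kaehlerBracket_jacobi

noncomputable instance : LieRingModule Ω[Z⁄k] Z where
  bracket ω r := anchor k Z ω r
  add_lie ω η r := by change anchor k Z (ω + η) r = _; rw [map_add]; rfl
  lie_add ω := map_add _
  leibniz_lie ω η r := by
    change anchor k Z ω (anchor k Z η r) = anchor k Z (kaehlerBracket ω η) r +
      anchor k Z η (anchor k Z ω r)
    rw [anchor_kaehlerBracket]; abel

theorem kaehler_lie (ω η : Ω[Z⁄k]) : ⁅ω, η⁆ = kaehlerBracket ω η := rfl

theorem kaehler_lie_apply (ω : Ω[Z⁄k]) (r : Z) : ⁅ω, r⁆ = anchor k Z ω r := rfl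

instance : LieRinehartRing Z Ω[Z⁄k] where
  lie_smul_eq_mul' r s ω := by
    rw [kaehler_lie_apply, map_smul]; rfl
  leibniz_mul_right' ω r s := by
    simp only [kaehler_lie_apply, Derivation.leibniz, smul_eq_mul]; ring
  leibniz_smul_right' ω η r := kaehlerBracket_smul ω r η

end PoissonAlgebra

/-! ### Adding a trivial module to a Lie–Rinehart algebra -/

/-- The Lie–Rinehart algebra `L ⊕ R^(J)`, in which `L` acts on the abelian ideal `R^(J)`
coordinatewise through its action on `R`. -/
def LieRinehartExt (R L J : Type*) [CommRing R] : Type _ := L × (J →₀ R)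

namespace LieRinehartExt

variable (R L J : Type*) [CommRing R] [LieRing L] [Module R L] [LieRingModule L R]

noncomputable instance : AddCommGroup (LieRinehartExt R L J) :=
  inferInstanceAs (AddCommGroup (L × (J →₀ R)))

noncomputable instance : Module R (LieRinehartExt R L J) :=
  inferInstanceAs (Module R (L × (J →₀ R)))

variable {R L J}

/-- The coordinatewise action of `L` on `R^(J)`. -/
noncomputable def coord (x : L) : (J →₀ R) →+ (J →₀ R) :=
  Finsupp.mapRange.addMonoidHom (LieRingModule.toEnd L R x : R →+ R)

noncomputable instance : LieRing (LieRinehartExt R L J) where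
  bracket x y := (⁅x.1, y.1⁆, coord x.1 y.2 - coord y.1 x.2)
  add_lie x y z := Prod.ext (add_lie _ _ _) (by
    ext j
    change ⁅x.1 + y.1, z.2 j⁆ - ⁅z.1, x.2 j + y.2 j⁆ =
      ⁅x.1, z.2 j⁆ - ⁅z.1, x.2 j⁆ + (⁅y.1, z.2 j⁆ - ⁅z.1, y.2 j⁆)
    rw [add_lie, lie_add]; abel)
  lie_add x y z := Prod.ext (lie_add _ _ _) (by
    ext j
    change ⁅x.1, y.2 j + z.2 j⁆ - ⁅y.1 + z.1, x.2 j⁆ =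
      ⁅x.1, y.2 j⁆ - ⁅y.1, x.2 j⁆ + (⁅x.1, z.2 j⁆ - ⁅z.1, x.2 j⁆)
    rw [add_lie, lie_add]; abel)
  lie_self x := Prod.ext (lie_self _) (sub_self _)
  leibniz_lie x y z := Prod.ext (leibniz_lie _ _ _) (by
    ext j
    change ⁅x.1, ⁅y.1, z.2 j⁆ - ⁅z.1, y.2 j⁆⁆ - ⁅⁅y.1, z.1⁆, x.2 j⁆ =
      ⁅⁅x.1, y.1⁆, z.2 j⁆ - ⁅z.1, ⁅x.1, y.2 j⁆ - ⁅y.1, x.2 j⁆⁆ +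
      (⁅y.1, ⁅x.1, z.2 j⁆ - ⁅z.1, x.2 j⁆⁆ - ⁅⁅x.1, z.1⁆, y.2 j⁆)
    simp only [lie_sub, lie_lie]; abel)

noncomputable instance : LieRingModule (LieRinehartExt R L J) R where
  bracket x r := ⁅x.1, r⁆
  add_lie x y r := add_lie x.1 y.1 r
  lie_add x r s := lie_add x.1 r s
  leibniz_lie x y r := leibniz_lie x.1 y.1 r

instance [LieRinehartRing R L] : LieRinehartRing R (LieRinehartExt R L J) where
  lie_smul_eq_mul' r s x := LieRinehartRing.lie_smul_eq_mul r s x.1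
  leibniz_mul_right' x r s := LieRinehartRing.leibniz_mul_right x.1 r s
  leibniz_smul_right' x y r := Prod.ext (LieRinehartRing.leibniz_smul_right x.1 y.1 r) (by
    ext j
    change ⁅x.1, r * y.2 j⁆ - ⁅r • y.1, x.2 j⁆ =
      r * (⁅x.1, y.2 j⁆ - ⁅y.1, x.2 j⁆) + ⁅x.1, r⁆ * y.2 j
    rw [LieRinehartRing.leibniz_mul_right, LieRinehartRing.lie_smul_eq_mul, smul_eq_mul]; ring)

end LieRinehartExt

/-! ### Generalities on Poisson enveloping algebras -/

namespace PoissonEnv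

section general

variable {k Z A : Type*} [Field k] [CommRing Z] [Algebra k Z]
  [PoissonAlgebra k Z] [Ring A] [Algebra k A] [Algebra Z A] [IsScalarTower k Z A]
  [PoissonOrder k Z A]

section lift

variable {B : Type*} [Ring B] [Algebra k B] (f : A →ₐ[k] B) (g : Z →ₗ[k] B)
  (hbracket : ∀ x y, g (PoissonAlgebra.bracket (k := k) x y) = g x * g y - g y * g x)
  (hham : ∀ x a, f (PoissonOrder.ham (k := k) x a) = g x * f a - f a * g x)
  (hmul : ∀ x y, g (x * y) = f (algebraMap Z A x) * g y + f (algebraMap Z A y) * g x)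

/-- The universal property of the Poisson enveloping algebra. -/
noncomputable def lift : PoissonEnv k Z A →ₐ[k] B :=
  RingQuot.liftAlgHom k ⟨FreeAlgebra.lift k (Sum.elim f g), by
    intro s t h
    induction h with
    | alpha_add a b => simp
    | alpha_mul a b => simp
    | alpha_algebraMap c => simp
    | delta_add z z' => simp
    | delta_smul c z => simp
    | delta_bracket z z' => simp [hbracket]
    | alpha_ham z a => simp [hham]
    | delta_mul z z' => simp [hmul]⟩

theorem lift_alpha (a : A) : lift f g hbracket hham hmul (alpha k Z A a) = f a := by
  change RingQuot.liftAlgHom k _ (RingQuot.mkAlgHom k _ _) = _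
  simp

theorem lift_delta (z : Z) : lift f g hbracket hham hmul (delta k Z A z) = g z := by
  change RingQuot.liftAlgHom k _ (RingQuot.mkAlgHom k _ _) = _
  simp

end lift

/-- An additive property which is stable under multiplication on the left by the generators and
holds for `1` holds for all elements. -/
theorem induction_left {P : PoissonEnv k Z A → Prop} (one : P 1)
    (add : ∀ u v, P u → P v → P (u + v)) (alpha_mul : ∀ a u, P u → P (alpha k Z A a * u))
    (delta_mul : ∀ z u, P u → P (delta k Z A z * u)) (u : PoissonEnv k Z A) : P u := by
  obtain ⟨x, rfl⟩ : ∃ x, mk k Z A x = u := RingQuot.mkAlgHom_surjective k (Rel k Z A) u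
  suffices h : ∀ v, P v → P (mk k Z A x * v) by simpa using h 1 one
  induction x using FreeAlgebra.induction with
  | grade0 c =>
    intro v hv
    have h := alpha_mul (algebraMap k A c) v hv
    rw [AlgHom.commutes] at h
    rw [AlgHom.commutes]
    exact h
  | grade1 x =>
    intro v hv
    rcases x with a | z
    · exact alpha_mul a v hv
    · exact delta_mul z v hv
  | mul x y hx hy =>
    intro v hv
    rw [map_mul, mul_assoc]
    exact hx _ (hy v hv)
  | add x y hx hy =>
    intro v hv
    rw [map_add, add_mul]
    exact add _ _ (hx v hv) (hy v hv)

/-- The enveloping algebra as a `Z`-module through left multiplication. -/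
noncomputable instance : Module Z (PoissonEnv k Z A) :=
  Module.compHom _ ((alpha k Z A).toRingHom.comp (algebraMap Z A))

theorem smul_def (z : Z) (u : PoissonEnv k Z A) :
    z • u = alpha k Z A (algebraMap Z A z) * u := rfl

instance : IsScalarTower k Z (PoissonEnv k Z A) :=
  IsScalarTower.of_algebraMap_smul fun c u => by
    rw [smul_def, ← IsScalarTower.algebraMap_apply, AlgHom.commutes, ← Algebra.smul_def]

variable (k Z A) in
/-- The action of `A^e` on `A`, with `δ z` acting as the Hamiltonian derivation of `z`. -/
noncomputable def actSelf : PoissonEnv k Z A →ₐ[k] Module.End k A :=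
  lift (Algebra.lmul k A) (PoissonOrder.ham (k := k) (Z := Z))
    (fun x y => by ext a; simp [PoissonOrder.ham_bracket])
    (fun x a => by ext b; simp [PoissonOrder.ham_mul])
    (fun x y => by ext b; simp [PoissonOrder.mul_ham, Algebra.smul_def])

theorem ham_one (z : Z) : PoissonOrder.ham (k := k) z (1 : A) = 0 := by
  have h := PoissonOrder.ham_mul (k := k) z (1 : A) 1
  simpa using h

/-- The augmentation `A^e → A`, a left `A`-linear retraction of `α`. -/
noncomputable def aug (u : PoissonEnv k Z A) : A := actSelf k Z A u 1

theorem aug_one : aug (1 : PoissonEnv k Z A) = 1 := by simp [aug]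

theorem aug_add (u v : PoissonEnv k Z A) : aug (u + v) = aug u + aug v := by simp [aug]

theorem aug_alpha_mul (a : A) (u : PoissonEnv k Z A) :
    aug (alpha k Z A a * u) = a * aug u := by
  simp [aug, actSelf, lift_alpha]

theorem aug_alpha (a : A) : aug (alpha k Z A a) = a := by
  rw [← mul_one (alpha k Z A a), aug_alpha_mul, aug_one, mul_one]

end general

/-! ### The Poincaré–Birkhoff–Witt theorem for `Z^e` -/

section PBW

variable {k Z : Type*} [Field k] [CommRing Z] [Algebra k Z] [PoissonAlgebra k Z]

theorem smul_def_self (z : Z) (u : PoissonEnv k Z Z) : z • u = alpha k Z Z z * u := rfl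

variable (k Z) in
/-- The linear map `Ω → Z^e` with `d z ↦ δ z`. -/
noncomputable def ofKaehler : Ω[Z⁄k] →ₗ[Z] PoissonEnv k Z Z :=
  (Derivation.mk' (delta k Z Z) (fun x y => delta_mul k Z Z x y)).liftKaehlerDifferential

theorem ofKaehler_D (z : Z) : ofKaehler k Z (KaehlerDifferential.D k Z z) = delta k Z Z z :=
  Derivation.liftKaehlerDifferential_comp_D _ _

theorem ofKaehler_mul_alpha (ω : Ω[Z⁄k]) (r : Z) : ofKaehler k Z ω * alpha k Z Z r =
    alpha k Z Z r * ofKaehler k Z ω + alpha k Z Z ⁅ω, r⁆ := by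
  induction ω using kaehler_induction with
  | D x =>
    rw [ofKaehler_D, PoissonAlgebra.kaehler_lie_apply, PoissonAlgebra.anchor_D]
    have h := alpha_ham k Z Z x r
    exact (add_comm _ _).trans (sub_eq_iff_eq_add.1 h.symm).symm |>.symm
  | add ω η h h' => rw [map_add, add_mul, h, h', mul_add, add_lie, map_add]; abel
  | smul s ω h =>
    rw [map_smul, smul_def_self, mul_assoc, h, LieRinehartRing.lie_smul_eq_mul, map_mul,
      mul_add, ← mul_assoc, ← map_mul, mul_comm s, map_mul, mul_assoc]

/-- Together with `ofKaehler_mul_alpha` this makes left multiplication on Z^e a module structure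
over the Lie–Rinehart algebra Ω. Both sides obey the same Leibniz rules, so exact differentials
decide. -/
theorem ofKaehler_lie (ω η : Ω[Z⁄k]) : ofKaehler k Z ⁅ω, η⁆ =
    ofKaehler k Z ω * ofKaehler k Z η - ofKaehler k Z η * ofKaehler k Z ω := by
  induction η using kaehler_induction with
  | D y =>
    induction ω using kaehler_induction with
    | D x =>
      rw [PoissonAlgebra.kaehler_lie, PoissonAlgebra.kaehlerBracket_D_D]
      simp only [ofKaehler_D, delta_bracket]
    | add ω η h h' => rw [add_lie, map_add, h, h', map_add, add_mul, mul_add]; abel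
    | smul s ω h =>
      rw [← lie_skew, LieRinehartRing.leibniz_smul_right, map_neg, map_add, map_smul, map_smul,
        ← lie_skew, map_neg, h, map_smul]
      simp only [smul_def_self]
      rw [← mul_assoc (ofKaehler k Z (KaehlerDifferential.D k Z y)), ofKaehler_mul_alpha]
      noncomm_ring
  | add η η' h h' => rw [lie_add, map_add, h, h', map_add, add_mul, mul_add]; abel
  | smul s η h =>
    rw [LieRinehartRing.leibniz_smul_right, map_add, map_smul, map_smul, h, map_smul]
    simp only [smul_def_self]
    rw [← mul_assoc (ofKaehler k Z ω), ofKaehler_mul_alpha]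
    noncomm_ring

variable (b : Module.Basis ℕ Z (LieRinehartExt Z Ω[Z⁄k] ℕ))

/-- A differential as an element of the extended Lie–Rinehart algebra. -/
noncomputable def inlExt (k Z : Type*) [Field k] [CommRing Z] [Algebra k Z] [PoissonAlgebra k Z] :
    Ω[Z⁄k] →ₗ[Z] LieRinehartExt Z Ω[Z⁄k] ℕ :=
  LinearMap.inl Z Ω[Z⁄k] (ℕ →₀ Z)

theorem inlExt_lie (ω η : Ω[Z⁄k]) : inlExt k Z ⁅ω, η⁆ = ⁅inlExt k Z ω, inlExt k Z η⁆ :=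
  Prod.ext rfl (by
    change (0 : ℕ →₀ Z) = LieRinehartExt.coord _ (0 : ℕ →₀ Z) - LieRinehartExt.coord _ (0 : ℕ →₀ Z)
    simp)

theorem inlExt_lie_apply (ω : Ω[Z⁄k]) (r : Z) : ⁅inlExt k Z ω, r⁆ = ⁅ω, r⁆ := rfl

/-- The anchor takes values in k-derivations, which kill constants. -/
theorem act_algebraMap_smul (x : LieRinehartExt Z Ω[Z⁄k] ℕ) (c : k) (v : Multiset ℕ →₀ Z) :
    LieRinehartPBW.act b x (c • v) = c • LieRinehartPBW.act b x v := by
  have h : ⁅x, algebraMap k Z c⁆ = 0 := (PoissonAlgebra.anchor k Z x.1).map_algebraMap c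
  rw [← algebraMap_smul Z c, LieRinehartPBW.act_smul, h, zero_smul, zero_add, algebraMap_smul]

/-- The action of a differential on polynomials, as a `k`-linear operator. -/
noncomputable def actKaehler (ω : Ω[Z⁄k]) : Module.End k (Multiset ℕ →₀ Z) where
  toFun := LieRinehartPBW.act b (inlExt k Z ω)
  map_add' := map_add _
  map_smul' := act_algebraMap_smul b _

/-- The action of `Z^e` on polynomials. -/
noncomputable def pbwAct : PoissonEnv k Z Z →ₐ[k] Module.End k (Multiset ℕ →₀ Z) :=
  lift (Algebra.lsmul k k (Multiset ℕ →₀ Z))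
    { toFun := fun z => actKaehler b (KaehlerDifferential.D k Z z)
      map_add' := fun x y => LinearMap.ext fun v => by
        change LieRinehartPBW.act b _ v = LieRinehartPBW.act b _ v + LieRinehartPBW.act b _ v
        rw [map_add, map_add, LieRinehartPBW.act_add_left]
      map_smul' := fun c x => LinearMap.ext fun v => by
        change LieRinehartPBW.act b _ v = c • LieRinehartPBW.act b _ v
        rw [Derivation.map_smul, ← algebraMap_smul Z c (KaehlerDifferential.D k Z x), map_smul,
          LieRinehartPBW.act_smul_left, algebraMap_smul] }
    (fun x y => LinearMap.ext fun v => by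
      change LieRinehartPBW.act b _ v = _
      rw [← PoissonAlgebra.kaehlerBracket_D_D, ← PoissonAlgebra.kaehler_lie, inlExt_lie,
        LieRinehartPBW.act_lie]; rfl)
    (fun x r => LinearMap.ext fun v => by
      change PoissonAlgebra.bracket (k := k) x r • v = LieRinehartPBW.act b _ (r • v) -
        r • LieRinehartPBW.act b _ v
      rw [LieRinehartPBW.act_smul, inlExt_lie_apply, PoissonAlgebra.kaehler_lie_apply,
        PoissonAlgebra.anchor_D, add_sub_cancel_right])
    (fun x y => LinearMap.ext fun v => by
      change LieRinehartPBW.act b _ v = x • LieRinehartPBW.act b _ v + y • LieRinehartPBW.act b _ v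
      rw [Derivation.leibniz, map_add, map_smul, map_smul, LieRinehartPBW.act_add_left,
        LieRinehartPBW.act_smul_left, LieRinehartPBW.act_smul_left])

theorem pbwAct_alpha (r : Z) (v : Multiset ℕ →₀ Z) : pbwAct b (alpha k Z Z r) v = r • v := by
  rw [pbwAct, lift_alpha]; rfl

theorem pbwAct_delta (z : Z) (v : Multiset ℕ →₀ Z) : pbwAct b (delta k Z Z z) v =
    LieRinehartPBW.act b (inlExt k Z (KaehlerDifferential.D k Z z)) v := by
  rw [pbwAct, lift_delta]; rfl

theorem pbwAct_ofKaehler (ω : Ω[Z⁄k]) (v : Multiset ℕ →₀ Z) :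
    pbwAct b (ofKaehler k Z ω) v = LieRinehartPBW.act b (inlExt k Z ω) v := by
  induction ω using kaehler_induction with
  | D x => rw [ofKaehler_D, pbwAct_delta]
  | add ω η h h' =>
    rw [map_add, map_add, LinearMap.add_apply, h, h', map_add, LieRinehartPBW.act_add_left]
  | smul s ω h =>
    rw [map_smul, smul_def_self, map_mul, Module.End.mul_apply, pbwAct_alpha, h, map_smul,
      LieRinehartPBW.act_smul_left]

/-- The linear map from `Z^e` to polynomials. -/
noncomputable def pbwSymbol : PoissonEnv k Z Z →ₗ[Z] (Multiset ℕ →₀ Z) where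
  toFun u := pbwAct b u (Finsupp.single 0 1)
  map_add' u v := by rw [map_add]; rfl
  map_smul' r u := by
    rw [smul_def_self, map_mul, Module.End.mul_apply, pbwAct_alpha]; rfl

/-- The linear map from polynomials to `Z^e`, sending an ordered monomial to the product. -/
noncomputable def pbwEval : (Multiset ℕ →₀ Z) →ₗ[Z] PoissonEnv k Z Z :=
  -- The added summand acts by zero; this is consistent because it is an ideal and acts trivially on
  -- Z.
  LieRinehartPBW.eval b (fun x => AddMonoidHom.mulLeft (ofKaehler k Z x.1)) 1

theorem pbwEval_act (x : LieRinehartExt Z Ω[Z⁄k] ℕ) (v : Multiset ℕ →₀ Z) :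
    pbwEval b (LieRinehartPBW.act b x v) = ofKaehler k Z x.1 * pbwEval b v := by
  refine LieRinehartPBW.eval_act b (fun x => AddMonoidHom.mulLeft (ofKaehler k Z x.1))
    (fun x y w => ?_) (fun r x w => ?_) (fun x r w => ?_) (fun x y w => ?_) 1 x v
  · change ofKaehler k Z (x.1 + y.1) * w = _
    rw [map_add, add_mul]; rfl
  · change ofKaehler k Z (r • x.1) * w = _
    rw [map_smul, smul_def_self, mul_assoc]; rfl
  · change ofKaehler k Z x.1 * (alpha k Z Z r * w) =
      alpha k Z Z ⁅x.1, r⁆ * w + alpha k Z Z r * (ofKaehler k Z x.1 * w)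
    rw [← mul_assoc, ofKaehler_mul_alpha, add_mul, mul_assoc, add_comm]
  · change ofKaehler k Z ⁅x.1, y.1⁆ * w = ofKaehler k Z x.1 * (ofKaehler k Z y.1 * w) -
      ofKaehler k Z y.1 * (ofKaehler k Z x.1 * w)
    rw [ofKaehler_lie, sub_mul, mul_assoc, mul_assoc]

/-- `pbwEval` intertwines the actions and sends the monomial 1 to 1, from which Z^e is generated by
left multiplication. -/
theorem pbwEval_pbwSymbol (u : PoissonEnv k Z Z) : pbwEval b (pbwSymbol b u) = u := by
  have h1 : pbwEval b (Finsupp.single 0 1) = 1 := LieRinehartPBW.eval_single_zero b _ _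
  induction u using induction_left with
  | one =>
    change pbwEval b (pbwAct b 1 (Finsupp.single 0 1)) = 1
    rw [map_one]; exact h1
  | add u v hu hv => rw [map_add, map_add, hu, hv]
  | alpha_mul r u hu => rw [← smul_def_self, map_smul, map_smul, hu]
  | delta_mul z u hu =>
    have h : pbwSymbol b (delta k Z Z z * u) =
        LieRinehartPBW.act b (inlExt k Z (KaehlerDifferential.D k Z z)) (pbwSymbol b u) := by
      change pbwAct b _ _ = _
      rw [map_mul, Module.End.mul_apply, pbwAct_delta]; rfl
    rw [h, pbwEval_act, hu]
    change ofKaehler k Z (KaehlerDifferential.D k Z z) * u = _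
    rw [ofKaehler_D]

end PBW

end PoissonEnv

/-! ### Unimodular families of functionals and countable generation -/

/-- If an ideal contains, for each member of a finite family with sum `1`, a power of it modulo the
previous members, then it is the unit ideal. -/
theorem Ideal.eq_top_of_pow_sub_mem_span {R : Type*} [CommRing R] (J : Ideal R) {m : ℕ}
    (f : Fin m → R) (hf : ∑ i, f i = 1) (c : Fin m → R) (n : Fin m → ℕ) (hc : ∀ i, c i ∈ J)
    (h : ∀ i, c i - f i ^ n i ∈ Ideal.span (f '' {i' | i' < i})) : J = ⊤ := by
  by_contra hJ
  obtain ⟨M, hM, hJM⟩ := Ideal.exists_le_maximal J hJ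
  -- A maximal ideal containing J and all earlier members contains a power of f_i, hence f_i; it
  -- would then contain the sum 1.
  have key : ∀ i, f i ∈ M := by
    intro i
    induction i using WellFoundedLT.induction with
    | ind i ih =>
      have h1 : c i - f i ^ n i ∈ M :=
        (Ideal.span_le.2 (by rintro _ ⟨i', hi', rfl⟩; exact ih i' hi') :
          Ideal.span (f '' {i' | i' < i}) ≤ M) (h i)
      have h2 := M.sub_mem (hJM (hc i)) h1
      rw [sub_sub_cancel] at h2
      exact hM.isPrime.mem_of_pow_mem _ h2
  exact hM.ne_top ((Ideal.eq_top_iff_one M).2 (hf ▸ M.sum_mem fun i _ => key i))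

theorem Module.exists_surjective_finsupp_nat {R P ι : Type*} [Ring R] [AddCommGroup P] [Module R P]
    [Countable ι] (s : ι → P) (hs : Submodule.span R (Set.range s) = ⊤) :
    ∃ f : (ℕ →₀ R) →ₗ[R] P, Function.Surjective f := by
  obtain ⟨⟩ := nonempty_encodable ι
  refine ⟨Finsupp.linearCombination R fun n => (Encodable.decode (α := ι) n).elim 0 s, ?_⟩
  rw [← LinearMap.range_eq_top, Finsupp.range_linearCombination, eq_top_iff, ← hs]
  refine Submodule.span_mono ?_
  rintro _ ⟨i, rfl⟩
  exact ⟨Encodable.encode i, by simp⟩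

theorem Module.Finite.exists_surjective_finsupp_nat (R P : Type*) [Ring R] [AddCommGroup P]
    [Module R P] [Module.Finite R P] : ∃ f : (ℕ →₀ R) →ₗ[R] P, Function.Surjective f := by
  obtain ⟨n, s, hs⟩ := Module.Finite.exists_fin (R := R) (M := P)
  exact Module.exists_surjective_finsupp_nat s hs

/-- A finitely generated projective module of nowhere zero rank is a generator. -/
theorem Module.exists_sum_dual_apply_eq_one {R P : Type*} [CommRing R] [AddCommGroup P]
    [Module R P] [Module.Finite R P] [Module.Projective R P]
    (h : ∀ p : PrimeSpectrum R, Module.rankAtStalk P p ≠ 0) :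
    ∃ (m : ℕ) (φ : Fin m → P →ₗ[R] R) (w : Fin m → P), ∑ i, φ i (w i) = 1 := by
  -- The trace ideal. Were it inside a maximal M, a dual basis would give P = MP, and Nakayama an r
  -- ≡ 1 mod M killing P, so that P would vanish at M.
  set T : Ideal R := Submodule.span R {r | ∃ (φ : P →ₗ[R] R) (w : P), φ w = r} with hT
  have hTtop : T = ⊤ := by
    by_contra hne
    obtain ⟨M, hM, hTM⟩ := Ideal.exists_le_maximal T hne
    obtain ⟨s, hs⟩ := Module.projective_def.1 (inferInstance : Module.Projective R P)
    have hle : (⊤ : Submodule R P) ≤ M • (⊤ : Submodule R P) := by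
      intro x _
      rw [← hs x, Finsupp.linearCombination_apply]
      refine Submodule.sum_mem _ fun y _ => Submodule.smul_mem_smul (hTM ?_) trivial
      exact Submodule.subset_span ⟨Finsupp.lapply y ∘ₗ s, x, rfl⟩
    obtain ⟨r, hr, hr'⟩ := Submodule.exists_sub_one_mem_and_smul_eq_zero_of_fg_of_le_smul M
      (⊤ : Submodule R P) Module.Finite.fg_top hle
    refine h ⟨M, hM.isPrime⟩ ((Module.rankAtStalk_eq_zero_iff_notMem_support _).2 fun hmem => ?_)
    obtain ⟨x, hx⟩ := Module.mem_support_iff'.1 hmem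
    refine hx r (fun hrM => hM.ne_top ((Ideal.eq_top_iff_one M).2 ?_)) (hr' x trivial)
    have := M.sub_mem hrM hr
    rwa [sub_sub_cancel] at this
  have h1 : (1 : R) ∈ T := by rw [hTtop]; trivial
  obtain ⟨m, a, g, hg⟩ := Submodule.mem_span_set'.1 h1
  choose φ w hφ using fun i => (g i).2
  refine ⟨m, fun i => a i • φ i, w, ?_⟩
  simpa [hφ] using hg

/-! ### Leading terms -/

namespace LieRinehartPBW

variable {R L I : Type*} [CommRing R] [LieRing L] [Module R L] [LieRingModule L R]
  [LieRinehartRing R L] (b : Module.Basis I R L) (φ : L →ₗ[R] R)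

/-- Evaluation of the homogeneous components of a polynomial at a linear functional on `L`. -/
noncomputable def components : (Multiset I →₀ R) →ₗ[R] (ℕ →₀ R) :=
  Finsupp.linearCombination R fun s => Finsupp.single s.card (s.map fun i => φ (b i)).prod

theorem components_single (s : Multiset I) : components b φ (Finsupp.single s 1) =
    Finsupp.single s.card (s.map fun i => φ (b i)).prod := by
  simp [components]

theorem components_eq_zero {n m : ℕ} (hnm : n < m) {v : Multiset I →₀ R}
    (hv : v ∈ degLE R I n) : components b φ v m = 0 := by
  refine degLE_induction (P := fun v => components b φ v m = 0) (by simp)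
    (fun v w hv hw => by rw [map_add, Finsupp.add_apply, hv, hw, add_zero])
    (fun r s hs => ?_) v hv
  rw [map_smul, components_single, Finsupp.smul_apply,
    Finsupp.single_eq_of_ne (by omega), smul_zero]

/-- Differentiating coefficients does not raise the degree, and the leading term of the action is
multiplication in the symmetric algebra, on which evaluation at φ is multiplicative. -/
theorem components_act [LinearOrder I] {n : ℕ} {v : Multiset I →₀ R} (hv : v ∈ degLE R I n)
    (x : L) : components b φ (act b x v) (n + 1) = φ x * components b φ v n := by
  refine degLE_induction
    (P := fun v => components b φ (act b x v) (n + 1) = φ x * components b φ v n) (by simp)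
    (fun v w hv hw => by
      simp only [map_add, Finsupp.add_apply, hv, hw, mul_add]) (fun r s hs => ?_) v hv
  have hx : x ∈ Submodule.span R (Set.range b) := by rw [b.span_eq]; trivial
  have key : components b φ (act b x (Finsupp.single s 1)) (n + 1) =
      φ x * components b φ (Finsupp.single s 1) n := by
    induction hx using Submodule.span_induction with
    | mem x hx =>
      obtain ⟨i, rfl⟩ := hx
      rw [← sub_add_cancel (act b (b i) (Finsupp.single s 1)) (Finsupp.single (i ::ₘ s) 1),
        map_add (components b φ), Finsupp.add_apply,
        components_eq_zero b φ n.lt_succ_self (degLE_mono hs (act_basis_sub_mem b i s)), zero_add,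
        components_single, components_single, Multiset.map_cons, Multiset.prod_cons,
        Multiset.card_cons, Finsupp.single_apply, Finsupp.single_apply]
      simp
    | zero => simp [act_zero_left]
    | add x y _ _ hx hy =>
      rw [act_add_left, map_add (components b φ), Finsupp.add_apply, hx, hy, map_add, add_mul]
    | smul a x _ hx =>
      rw [act_smul_left, map_smul, Finsupp.smul_apply, hx, map_smul, smul_eq_mul, smul_eq_mul,
        mul_assoc]
  rw [act_smul, map_add (components b φ), map_smul, map_smul, Finsupp.add_apply, Finsupp.smul_apply,
    Finsupp.smul_apply, key, components_eq_zero b φ n.lt_succ_self (single_mem_degLE hs _),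
    smul_zero, zero_add, map_smul, Finsupp.smul_apply, smul_eq_mul, smul_eq_mul]
  ring

end LieRinehartPBW

/-! ### The module structure of `Z^e` -/

namespace PoissonEnv

open LieRinehartPBW

variable {k Z : Type*} [Field k] [CommRing Z] [Algebra k Z] [PoissonAlgebra k Z]

section

variable (b : Module.Basis ℕ Z (LieRinehartExt Z Ω[Z⁄k] ℕ))

theorem pbwSymbol_ofKaehler_mul (ω : Ω[Z⁄k]) (u : PoissonEnv k Z Z) :
    pbwSymbol b (ofKaehler k Z ω * u) = act b (inlExt k Z ω) (pbwSymbol b u) := by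
  change pbwAct b _ _ = _
  rw [map_mul, Module.End.mul_apply, pbwAct_ofKaehler]; rfl

theorem pbwSymbol_one : pbwSymbol b 1 = Finsupp.single 0 1 := by
  change pbwAct b 1 _ = _
  rw [map_one, Module.End.one_apply]

theorem pbwSymbol_pow_mem (ω : Ω[Z⁄k]) (n : ℕ) :
    pbwSymbol b (ofKaehler k Z ω ^ n) ∈ degLE Z ℕ n := by
  induction n with
  | zero => rw [pow_zero, pbwSymbol_one]; exact single_mem_degLE (by simp) _
  | succ n ih => rw [pow_succ', pbwSymbol_ofKaehler_mul]; exact act_mem b _ ih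

theorem components_pbwSymbol_pow (φ : LieRinehartExt Z Ω[Z⁄k] ℕ →ₗ[Z] Z) (ω : Ω[Z⁄k]) (n : ℕ) :
    components b φ (pbwSymbol b (ofKaehler k Z ω ^ n)) n = φ (inlExt k Z ω) ^ n := by
  induction n with
  | zero => simp [pbwSymbol_one, components_single]
  | succ n ih =>
    rw [pow_succ', pbwSymbol_ofKaehler_mul, components_act b φ (pbwSymbol_pow_mem b ω n), ih,
      pow_succ']

theorem projective_of_basis (b : Module.Basis ℕ Z (LieRinehartExt Z Ω[Z⁄k] ℕ)) :
    Module.Projective Z (PoissonEnv k Z Z) :=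
  Module.Projective.of_split (pbwSymbol b) (pbwEval b)
    (LinearMap.ext fun u => pbwEval_pbwSymbol b u)

theorem exists_surjective_finsupp_of_basis
    (b : Module.Basis ℕ Z (LieRinehartExt Z Ω[Z⁄k] ℕ)) :
    ∃ f : (ℕ →₀ Z) →ₗ[Z] PoissonEnv k Z Z, Function.Surjective f := by
  refine Module.exists_surjective_finsupp_nat (fun s => pbwEval b (Finsupp.single s 1)) ?_
  rw [eq_top_iff]
  rintro u -
  rw [← pbwEval_pbwSymbol b u]
  generalize pbwSymbol b u = v
  refine finsupp_induction (P := fun v => pbwEval b v ∈ _) (by simp)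
    (fun v w hv hw => by rw [map_add]; exact add_mem hv hw) (fun r s => ?_) v
  rw [map_smul]
  exact Submodule.smul_mem _ _ (Submodule.subset_span ⟨s, rfl⟩)

/-- The slot `q` of the value at `v` is the sum over `i` of `φ i (w i)` times the value at `φ i` of
the homogeneous component of `v` of degree `m * q + i`. -/
noncomputable def slots {m : ℕ} (φ : Fin m → LieRinehartExt Z Ω[Z⁄k] ℕ →ₗ[Z] Z) (f : Fin m → Z) :
    (Multiset ℕ →₀ Z) →ₗ[Z] (ℕ →₀ Z) :=
  ∑ i, f i • (Finsupp.lcomapDomain (fun q => m * q + i) (fun q q' h => by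
    have hm : 0 < m := i.pos
    have h' : m * q + i = m * q' + i := h
    exact Nat.eq_of_mul_eq_mul_left hm (by omega)) ∘ₗ components b (φ i))

theorem slots_apply {m : ℕ} (φ : Fin m → LieRinehartExt Z Ω[Z⁄k] ℕ →ₗ[Z] Z) (f : Fin m → Z)
    (v : Multiset ℕ →₀ Z) (q : ℕ) :
    slots b φ f v q = ∑ i, f i * components b (φ i) v (m * q + i) := by
  simp [slots, Finsupp.lcomapDomain, Finsupp.finsetSum_apply]

/-- A single functional on Ω need not be onto, so degrees are grouped in blocks of length m. The
power of w_i with exponent mq + i has no component in slots above q. In slot q, the terms i' > i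
vanish by degree, i' = i contributes a power of f_i, and i' < i contributes multiples of f_{i'}.
This triangular shape and ∑ f_i = 1 make slot q attain every value modulo lower slots, which are
covered by induction on q. -/
theorem slots_pbwSymbol_surjective {m : ℕ} (φ : Fin m → LieRinehartExt Z Ω[Z⁄k] ℕ →ₗ[Z] Z)
    (w : Fin m → Ω[Z⁄k]) (h : ∑ i, φ i (inlExt k Z (w i)) = 1) : Function.Surjective
      (slots b φ (fun i => φ i (inlExt k Z (w i))) ∘ₗ pbwSymbol b) := by
  set f : Fin m → Z := fun i => φ i (inlExt k Z (w i)) with hf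
  set Ψ := slots b φ f ∘ₗ pbwSymbol b with hΨ
  rw [← LinearMap.range_eq_top]
  suffices hs : ∀ q, ∀ r, Finsupp.single q r ∈ LinearMap.range Ψ by
    rw [eq_top_iff]
    rintro v -
    rw [← Finsupp.sum_single v]
    exact Submodule.sum_mem _ fun q _ => hs q _
  intro q
  induction q using Nat.strong_induction_on with
  | _ q ih =>
    have hlow : ∀ v : ℕ →₀ Z, (∀ q', q ≤ q' → v q' = 0) → v ∈ LinearMap.range Ψ := by
      intro v hv
      rw [← Finsupp.sum_single v]
      refine Submodule.sum_mem _ fun q' hq' => ih q' ?_ _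
      by_contra hle
      exact (Finsupp.mem_support_iff.1 hq') (hv q' (not_lt.1 hle))
    set J : Ideal Z := (LinearMap.range Ψ).comap (Finsupp.lsingle q) with hJ
    suffices hJtop : J = ⊤ by
      intro r
      have : r ∈ J := by rw [hJtop]; trivial
      exact this
    set u : Fin m → PoissonEnv k Z Z := fun i => ofKaehler k Z (w i) ^ (m * q + i) with hu
    refine Ideal.eq_top_of_pow_sub_mem_span J f h (fun i => Ψ (u i) q)
      -- The extra 1 is the weight f_i that `slots` attaches to the i-th functional.
      (fun i => m * q + i + 1) (fun i => ?_) (fun i => ?_)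
    · change Finsupp.single q (Ψ (u i) q) ∈ LinearMap.range Ψ
      have h1 : Ψ (u i) - (Ψ (u i) - Finsupp.single q (Ψ (u i) q)) ∈ LinearMap.range Ψ := by
        refine Submodule.sub_mem _ (LinearMap.mem_range_self _ _) (hlow _ fun q' hq' => ?_)
        rcases hq'.eq_or_lt with rfl | hlt
        · simp
        · rw [Finsupp.sub_apply, Finsupp.single_eq_of_ne hlt.ne', sub_zero]
          change slots b φ f (pbwSymbol b (u i)) q' = 0
          rw [slots_apply]
          refine Finset.sum_eq_zero fun i' _ => ?_
          rw [components_eq_zero b (φ i') _ (pbwSymbol_pow_mem b (w i) (m * q + i)), mul_zero]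
          have h2 : m * (q + 1) ≤ m * q' := Nat.mul_le_mul_left m hlt
          have h3 := i.2
          rw [mul_add] at h2
          omega
      rwa [sub_sub_cancel] at h1
    · change slots b φ f (pbwSymbol b (u i)) q - _ ∈ _
      rw [slots_apply, ← Finset.add_sum_erase _ _ (Finset.mem_univ i),
        components_pbwSymbol_pow b (φ i) (w i), pow_succ', add_sub_cancel_left]
      refine Submodule.sum_mem _ fun i' hi' => ?_
      rcases lt_or_gt_of_ne (Finset.ne_of_mem_erase hi') with hlt | hgt
      · exact Ideal.mul_mem_right _ _ (Ideal.subset_span ⟨i', hlt, rfl⟩)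
      · have hlt : (i : ℕ) < i' := hgt
        rw [components_eq_zero b (φ i') (by omega) (pbwSymbol_pow_mem b (w i) (m * q + i)),
          mul_zero]
        exact Submodule.zero_mem _

end

/-! ### Projectivity and freeness of Z^e in the smooth case -/

section smooth

variable (k Z) [Algebra.Smooth k Z]

/-- Smoothness makes Ω finitely generated projective, so Z^(ℕ) absorbs it. -/
theorem nonempty_basis_ext : Nonempty (Module.Basis ℕ Z (LieRinehartExt Z Ω[Z⁄k] ℕ)) := by
  obtain ⟨f, hf⟩ := Module.Finite.exists_surjective_finsupp_nat Z Ω[Z⁄k]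
  obtain ⟨e⟩ := Module.Projective.exists_prod_finsupp_equiv f hf
  exact ⟨Module.Basis.ofRepr (M := LieRinehartExt Z Ω[Z⁄k] ℕ) e⟩

/-- The enveloping algebra of a smooth Poisson algebra is projective as a module. -/
instance projective_self : Module.Projective Z (PoissonEnv k Z Z) :=
  let ⟨b⟩ := nonempty_basis_ext k Z
  projective_of_basis b

/-- Nowhere zero rank makes Ω a generator. Its functionals, extended by zero to the added summand,
map Z^e onto Z^(ℕ), and the swindle applies. -/
theorem free_of_rank_ne_zero (h : ∀ p : PrimeSpectrum Z, Module.rankAtStalk Ω[Z⁄k] p ≠ 0) :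
    Module.Free Z (PoissonEnv k Z Z) := by
  obtain ⟨b⟩ := nonempty_basis_ext k Z
  obtain ⟨m, φ, w, hφ⟩ := Module.exists_sum_dual_apply_eq_one h
  obtain ⟨f, hf⟩ := exists_surjective_finsupp_of_basis b
  exact Module.Projective.free_of_surjective f hf _
    (slots_pbwSymbol_surjective b (fun i => φ i ∘ₗ LinearMap.fst Z Ω[Z⁄k] (ℕ →₀ Z)) w hφ)

/-- Here Ω = 0, so δ vanishes and α is onto; the augmentation shows that α is injective. -/
theorem free_of_rank_eq_zero (h : ∀ p : PrimeSpectrum Z, Module.rankAtStalk Ω[Z⁄k] p = 0) :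
    Module.Free Z (PoissonEnv k Z Z) := by
  have hΩ : Subsingleton Ω[Z⁄k] := Module.rankAtStalk_eq_zero_iff_subsingleton.1 (funext h)
  let f : Z →ₗ[Z] PoissonEnv k Z Z := LinearMap.toSpanSingleton Z _ 1
  have hf : ∀ z, f z = alpha k Z Z z := fun z => (smul_def_self z 1).trans (mul_one _)
  refine Module.Free.of_equiv (LinearEquiv.ofBijective f ⟨fun x y hxy => ?_, fun u => ?_⟩)
  · rw [hf, hf] at hxy
    rw [← aug_alpha (k := k) (Z := Z) x, hxy, aug_alpha]
  · induction u using induction_left with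
    | one => exact ⟨1, by rw [hf, map_one]⟩
    | add u v hu hv =>
      obtain ⟨x, rfl⟩ := hu
      obtain ⟨y, rfl⟩ := hv
      exact ⟨x + y, map_add f x y⟩
    | alpha_mul a u hu =>
      obtain ⟨x, rfl⟩ := hu
      exact ⟨a * x, by rw [hf, hf, map_mul]⟩
    | delta_mul z u hu =>
      refine ⟨0, ?_⟩
      rw [map_zero, ← ofKaehler_D, Subsingleton.elim (KaehlerDifferential.D k Z z) 0, map_zero,
        zero_mul]

end smooth

end PoissonEnv

/-! ### The decomposition `A^e = A ⊗ Z^e` -/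

namespace PoissonEnv

variable (k Z A : Type*) [Field k] [CommRing Z] [Algebra k Z]
  [PoissonAlgebra k Z] [Ring A] [Algebra k A] [Algebra Z A] [IsScalarTower k Z A]
  [PoissonOrder k Z A]

theorem natMap_smul (z : Z) (u : PoissonEnv k Z Z) : natMap k Z A (z • u) = z • natMap k Z A u := by
  rw [smul_def_self, smul_def, map_mul, natMap_alpha]

/-- The map `A ⊗ Z^e → A^e` given by multiplication. -/
noncomputable def mulMap : A ⊗[Z] PoissonEnv k Z Z →ₗ[Z] PoissonEnv k Z A :=
  TensorProduct.lift (LinearMap.mk₂ Z (fun a u => alpha k Z A a * natMap k Z A u)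
    (fun a b u => by rw [map_add, add_mul])
    (fun z a u => by rw [Algebra.smul_def, map_mul, smul_def, mul_assoc])
    (fun a u v => by rw [map_add, mul_add])
    (fun z a u => by
      rw [natMap_smul, smul_def, smul_def, ← mul_assoc, ← mul_assoc, ← map_mul, ← map_mul,
        Algebra.commutes]))

theorem mulMap_tmul (a : A) (u : PoissonEnv k Z Z) :
    mulMap k Z A (a ⊗ₜ u) = alpha k Z A a * natMap k Z A u := rfl

variable {k Z A} in
theorem delta_mul_smul (z r : Z) (u : PoissonEnv k Z Z) : delta k Z Z z * (r • u) =
    r • (delta k Z Z z * u) + PoissonAlgebra.bracket (k := k) z r • u := by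
  have h : alpha k Z Z (PoissonAlgebra.bracket (k := k) z r) = _ := alpha_ham k Z Z z r
  simp only [smul_def_self, h]
  noncomm_ring

variable {k Z} in
/-- The biadditive map inducing `deltaTensor`. -/
noncomputable def deltaTensorAux (z : Z) :
    A →+ PoissonEnv k Z Z →+ A ⊗[Z] PoissonEnv k Z Z where
  toFun a :=
    { toFun := fun u => PoissonOrder.ham (k := k) z a ⊗ₜ[Z] u + a ⊗ₜ[Z] (delta k Z Z z * u)
      map_zero' := by simp
      map_add' := fun u v => by simp only [mul_add, TensorProduct.tmul_add]; abel }
  map_zero' := by ext u; simp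
  map_add' a b := AddMonoidHom.ext fun u => by
    change PoissonOrder.ham (k := k) z (a + b) ⊗ₜ[Z] u + (a + b) ⊗ₜ[Z] (delta k Z Z z * u) =
      PoissonOrder.ham (k := k) z a ⊗ₜ[Z] u + a ⊗ₜ[Z] (delta k Z Z z * u) +
        (PoissonOrder.ham (k := k) z b ⊗ₜ[Z] u + b ⊗ₜ[Z] (delta k Z Z z * u))
    simp only [map_add, TensorProduct.add_tmul]
    abel

variable {k Z} in
/-- The action of `δ z` on `A ⊗ Z^e`. -/
noncomputable def deltaTensor (z : Z) : A ⊗[Z] PoissonEnv k Z Z →+ A ⊗[Z] PoissonEnv k Z Z :=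
  TensorProduct.liftAddHom (deltaTensorAux A z) (fun r a u => by
    change PoissonOrder.ham (k := k) z (r • a) ⊗ₜ[Z] u + (r • a) ⊗ₜ[Z] (delta k Z Z z * u) =
      PoissonOrder.ham (k := k) z a ⊗ₜ[Z] (r • u) + a ⊗ₜ[Z] (delta k Z Z z * (r • u))
    -- Neither summand is balanced over Z on its own: each yields a term with coefficient {z, r}, on
    -- opposite sides of the tensor sign, and these agree.
    have h : PoissonOrder.ham (k := k) z (r • a) =
        r • PoissonOrder.ham (k := k) z a + PoissonAlgebra.bracket (k := k) z r • a := by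
      rw [Algebra.smul_def, PoissonOrder.ham_mul, PoissonOrder.ham_algebraMap, Algebra.smul_def,
        Algebra.smul_def, add_comm]
    simp only [h, delta_mul_smul, TensorProduct.add_tmul, TensorProduct.tmul_add,
      TensorProduct.smul_tmul]
    abel)

variable {k Z A} in
theorem deltaTensor_tmul (z : Z) (a : A) (u : PoissonEnv k Z Z) :
    deltaTensor A z (a ⊗ₜ u) =
      PoissonOrder.ham (k := k) z a ⊗ₜ[Z] u + a ⊗ₜ[Z] (delta k Z Z z * u) := rfl

theorem tensor_end_ext {f g : Module.End k (A ⊗[Z] PoissonEnv k Z Z)}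
    (h : ∀ a u, f (a ⊗ₜ u) = g (a ⊗ₜ u)) : f = g := by
  ext t
  induction t using TensorProduct.induction_on with
  | zero => simp
  | tmul a u => exact h a u
  | add t t' ht ht' => rw [map_add, map_add, ht, ht']

variable {k Z} in
/-- The action of `δ z` on `A ⊗ Z^e`, as a `k`-linear map. -/
noncomputable def deltaTensorEnd (z : Z) : Module.End k (A ⊗[Z] PoissonEnv k Z Z) where
  toFun := deltaTensor A z
  map_add' := map_add _
  map_smul' c t := by
    induction t using TensorProduct.induction_on with
    | zero => simp
    | tmul a u =>
      simp only [TensorProduct.smul_tmul', deltaTensor_tmul, map_smul, RingHom.id_apply, smul_add]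
    | add t t' ht ht' => rw [smul_add, map_add, ht, ht', map_add, smul_add]

/-- The action of `A^e` on `A ⊗ Z^e`. -/
noncomputable def actTensor : PoissonEnv k Z A →ₐ[k] Module.End k (A ⊗[Z] PoissonEnv k Z Z) :=
  lift (Algebra.lsmul k k (A ⊗[Z] PoissonEnv k Z Z))
    { toFun := fun z => deltaTensorEnd A z
      map_add' := fun x y => tensor_end_ext k Z A fun a u => by
        change deltaTensor (k := k) A (x + y) (a ⊗ₜ u) =
          deltaTensor (k := k) A x (a ⊗ₜ u) + deltaTensor (k := k) A y (a ⊗ₜ u)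
        simp only [deltaTensor_tmul, map_add, LinearMap.add_apply, add_mul, TensorProduct.tmul_add,
          TensorProduct.add_tmul]
        abel
      map_smul' := fun c x => tensor_end_ext k Z A fun a u => by
        change deltaTensor (k := k) A (c • x) (a ⊗ₜ u) = c • deltaTensor (k := k) A x (a ⊗ₜ u)
        simp only [deltaTensor_tmul, map_smul, LinearMap.smul_apply, smul_mul_assoc,
          TensorProduct.tmul_smul, smul_add, TensorProduct.smul_tmul'] }
    (fun x y => tensor_end_ext k Z A fun a u => by
      change deltaTensor A (PoissonAlgebra.bracket (k := k) x y) (a ⊗ₜ u) =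
        deltaTensor (k := k) A x (deltaTensor (k := k) A y (a ⊗ₜ u)) -
          deltaTensor (k := k) A y (deltaTensor (k := k) A x (a ⊗ₜ u))
      simp only [deltaTensor_tmul, PoissonOrder.ham_bracket, map_add, delta_bracket, sub_mul,
        TensorProduct.tmul_sub, TensorProduct.sub_tmul, mul_assoc]
      abel)
    (fun x a => tensor_end_ext k Z A fun b u => by
      change PoissonOrder.ham (k := k) x a • b ⊗ₜ[Z] u =
        deltaTensor A x (a • b ⊗ₜ[Z] u) - a • deltaTensor A x (b ⊗ₜ u)
      simp only [TensorProduct.smul_tmul', smul_eq_mul, deltaTensor_tmul, PoissonOrder.ham_mul,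
        smul_add, TensorProduct.add_tmul]
      abel)
    (fun x y => tensor_end_ext k Z A fun a u => by
      change deltaTensor (k := k) A (x * y) (a ⊗ₜ u) =
        algebraMap Z A x • deltaTensor A y (a ⊗ₜ u) +
          algebraMap Z A y • deltaTensor A x (a ⊗ₜ u)
      have h : delta k Z Z (x * y) = x • delta k Z Z y + y • delta k Z Z x := delta_mul k Z Z x y
      simp only [deltaTensor_tmul, PoissonOrder.mul_ham, algebraMap_smul, h, add_mul,
        TensorProduct.tmul_add, TensorProduct.add_tmul, smul_add, smul_def_self, mul_assoc]
      simp only [← smul_def_self, TensorProduct.tmul_smul, TensorProduct.smul_tmul']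
      abel)

variable {k Z A}

theorem actTensor_alpha (a : A) (t : A ⊗[Z] PoissonEnv k Z Z) :
    actTensor k Z A (alpha k Z A a) t = a • t := by
  rw [actTensor, lift_alpha]; rfl

theorem actTensor_delta (z : Z) (t : A ⊗[Z] PoissonEnv k Z Z) :
    actTensor k Z A (delta k Z A z) t = deltaTensor A z t := by
  rw [actTensor, lift_delta]; rfl

/-- Hamiltonian derivations kill 1_A, so on tensors 1 ⊗ u only left multiplication in Z^e survives.
-/
theorem actTensor_natMap (u : PoissonEnv k Z Z) :
    actTensor k Z A (natMap k Z A u) (1 ⊗ₜ 1) = 1 ⊗ₜ u := by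
  induction u using induction_left with
  | one => rw [map_one, map_one, Module.End.one_apply]
  | add u v hu hv => rw [map_add, map_add, LinearMap.add_apply, hu, hv, TensorProduct.tmul_add]
  | alpha_mul r u hu =>
    rw [map_mul, map_mul, Module.End.mul_apply, hu, natMap_alpha, actTensor_alpha,
      ← smul_def_self, TensorProduct.tmul_smul, algebraMap_smul]
  | delta_mul z u hu =>
    rw [map_mul, map_mul, Module.End.mul_apply, hu, natMap_delta, actTensor_delta,
      deltaTensor_tmul, ham_one, TensorProduct.zero_tmul, zero_add]

theorem mulMap_smul (a : A) (t : A ⊗[Z] PoissonEnv k Z Z) :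
    mulMap k Z A (a • t) = alpha k Z A a * mulMap k Z A t := by
  induction t using TensorProduct.induction_on with
  | zero => simp
  | tmul b u => rw [TensorProduct.smul_tmul', mulMap_tmul, mulMap_tmul, smul_eq_mul, map_mul,
      mul_assoc]
  | add t t' ht ht' => rw [smul_add, map_add, map_add, ht, ht', mul_add]

theorem mulMap_deltaTensor (z : Z) (t : A ⊗[Z] PoissonEnv k Z Z) :
    mulMap k Z A (deltaTensor A z t) = delta k Z A z * mulMap k Z A t := by
  induction t using TensorProduct.induction_on with
  | zero => simp
  | tmul b u =>
    rw [deltaTensor_tmul, map_add, mulMap_tmul, mulMap_tmul, mulMap_tmul, map_mul, natMap_delta,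
      alpha_ham]
    noncomm_ring
  | add t t' ht ht' => rw [map_add, map_add, map_add, ht, ht', mul_add]

/-- Multiplication is equivariant for A^e and sends 1 ⊗ 1 to 1, which generates A^e. -/
theorem mulMap_actTensor (x : PoissonEnv k Z A) :
    mulMap k Z A (actTensor k Z A x (1 ⊗ₜ 1)) = x := by
  induction x using induction_left with
  | one => rw [map_one, Module.End.one_apply, mulMap_tmul, map_one, map_one, mul_one]
  | add u v hu hv => rw [map_add, LinearMap.add_apply, map_add, hu, hv]
  | alpha_mul a u hu => rw [map_mul, Module.End.mul_apply, actTensor_alpha, mulMap_smul, hu]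
  | delta_mul z u hu =>
    rw [map_mul, Module.End.mul_apply, actTensor_delta, mulMap_deltaTensor, hu]

theorem actTensor_mulMap (t : A ⊗[Z] PoissonEnv k Z Z) :
    actTensor k Z A (mulMap k Z A t) (1 ⊗ₜ 1) = t := by
  induction t using TensorProduct.induction_on with
  | zero => simp
  | tmul a u =>
    rw [mulMap_tmul, map_mul, Module.End.mul_apply, actTensor_natMap, actTensor_alpha,
      TensorProduct.smul_tmul', smul_eq_mul, mul_one]
  | add t t' ht ht' => rw [map_add, map_add, LinearMap.add_apply, ht, ht']

/-- The enveloping algebra `A^e` is `A ⊗ Z^e`. -/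
noncomputable def tensorEquiv : PoissonEnv k Z A ≃+ A ⊗[Z] PoissonEnv k Z Z where
  toFun x := actTensor k Z A x (1 ⊗ₜ 1)
  invFun := mulMap k Z A
  left_inv := mulMap_actTensor
  right_inv := actTensor_mulMap
  map_add' x y := by rw [map_add, LinearMap.add_apply]

theorem tensorEquiv_alpha_mul_natMap (a : A) (u : PoissonEnv k Z Z) :
    tensorEquiv (alpha k Z A a * natMap k Z A u) = a ⊗ₜ u :=
  actTensor_mulMap (a ⊗ₜ u)

theorem tensorEquiv_alpha_mul (a : A) (x : PoissonEnv k Z A) :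
    tensorEquiv (alpha k Z A a * x) = a • tensorEquiv x := by
  change actTensor k Z A _ _ = _
  rw [map_mul, Module.End.mul_apply, actTensor_alpha]; rfl

/-- An additive property of elements of `A^e` can be checked on the products `α a * natMap u`. -/
theorem induction_mul {P : PoissonEnv k Z A → Prop} (zero : P 0)
    (add : ∀ x y, P x → P y → P (x + y))
    (mul : ∀ a u, P (alpha k Z A a * natMap k Z A u)) (x : PoissonEnv k Z A) : P x := by
  rw [← mulMap_actTensor x]
  generalize actTensor k Z A x (1 ⊗ₜ 1) = t
  induction t using TensorProduct.induction_on with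
  | zero => simpa using zero
  | tmul a u => exact mul a u
  | add t t' ht ht' => rw [map_add]; exact add _ _ ht ht'

/-- Under A^e ≅ A ⊗ Z^e the natural map is Z → A tensored with Z^e, which is flat because it is
projective. -/
theorem natMap_injective [Module.Projective Z (PoissonEnv k Z Z)]
    (h : Function.Injective (algebraMap Z A)) : Function.Injective (natMap k Z A) := by
  have hflat := Module.Flat.rTensor_preserves_injective_linearMap (M := PoissonEnv k Z Z)
    (Algebra.linearMap Z A) h
  intro u v huv
  have h1 : ∀ u, (Algebra.linearMap Z A).rTensor (PoissonEnv k Z Z) (1 ⊗ₜ u) =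
      tensorEquiv (natMap k Z A u) := fun u => by
    rw [LinearMap.rTensor_tmul, Algebra.linearMap_apply, map_one]
    exact (actTensor_natMap u).symm
  have h2 := hflat (((h1 u).trans (congrArg tensorEquiv huv)).trans (h1 v).symm)
  simpa using congrArg (TensorProduct.lid Z (PoissonEnv k Z Z)) h2

/-! ### A^e as a left A-module -/

section left

variable (k Z A)

/-- `tensorEquiv` as an `A`-linear equivalence. -/
noncomputable def tensorLinearEquiv :
    let := (alpha k Z A).toRingHom.leftModule
    PoissonEnv k Z A ≃ₗ[A] A ⊗[Z] PoissonEnv k Z Z :=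
  let := (alpha k Z A).toRingHom.leftModule
  { tensorEquiv with map_smul' := tensorEquiv_alpha_mul }

theorem free_left_alpha [Module.Free Z (PoissonEnv k Z Z)] :
    @Module.Free A (PoissonEnv k Z A) _ _ (alpha k Z A).toRingHom.leftModule :=
  let := (alpha k Z A).toRingHom.leftModule
  Module.Free.of_equiv (tensorLinearEquiv k Z A).symm

theorem projective_left_alpha [Module.Projective Z (PoissonEnv k Z Z)] :
    @Module.Projective A _ (PoissonEnv k Z A) _ (alpha k Z A).toRingHom.leftModule :=
  let := (alpha k Z A).toRingHom.leftModule
  Module.Projective.of_equiv (tensorLinearEquiv k Z A).symm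

end left

/-! ### A^e as a right Z^e-module -/

section right

variable {I : Type*} (b : I → A) (s : A →ₗ[Z] (I →₀ Z))

/-- The coordinates on `A ⊗ Z^e` over `Z^e` given by coordinates on `A` over `Z`. -/
noncomputable def tensorCoords : A ⊗[Z] PoissonEnv k Z Z →ₗ[Z] (I →₀ PoissonEnv k Z Z) :=
  TensorProduct.lift (LinearMap.mk₂ Z
    (fun a u => Finsupp.mapRange.linearMap (LinearMap.toSpanSingleton Z (PoissonEnv k Z Z) u) (s a))
    (fun a b u => by rw [map_add, map_add])
    (fun z a u => by rw [map_smul, map_smul])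
    (fun a u v => by ext i; simp)
    (fun z a u => by ext i; simp [smul_comm z]))

/-- The coordinates on `A^e` over `Z^e` given by coordinates on `A` over `Z`. -/
noncomputable def coords : PoissonEnv k Z A →+ (I →₀ PoissonEnv k Z Z) :=
  (tensorCoords s).toAddMonoidHom.comp (tensorEquiv (k := k) (Z := Z) (A := A)).toAddMonoidHom

theorem coords_mul_eq (a : A) (u : PoissonEnv k Z Z) :
    coords s (alpha k Z A a * natMap k Z A u) = Finsupp.mapRange.linearMap
      (LinearMap.toSpanSingleton Z (PoissonEnv k Z Z) u) (s a) := by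
  change tensorCoords s (tensorEquiv (alpha k Z A a * natMap k Z A u)) = _
  rw [tensorEquiv_alpha_mul_natMap]
  rfl

theorem coords_mul (a : A) (u : PoissonEnv k Z Z) (i : I) :
    coords s (alpha k Z A a * natMap k Z A u) i = s a i • u := by
  rw [coords_mul_eq]; simp

theorem coords_mul_natMap (x : PoissonEnv k Z A) (v : PoissonEnv k Z Z) :
    coords s (x * natMap k Z A v) = MulOpposite.op v • coords s x := by
  induction x using induction_mul with
  | zero => simp
  | add x y hx hy => rw [add_mul, map_add, hx, hy, map_add, smul_add]
  | mul a u =>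
    ext i
    rw [mul_assoc, ← map_mul, coords_mul, Finsupp.smul_apply, coords_mul, smul_def_self,
      smul_def_self, op_smul_eq_mul, mul_assoc]

/-- The combination of the `α (b i)` with right coefficients in `Z^e`. -/
noncomputable def ofCoords : (I →₀ PoissonEnv k Z Z) →+ PoissonEnv k Z A :=
  Finsupp.liftAddHom fun i =>
    (AddMonoidHom.mulLeft (alpha k Z A (b i))).comp (natMap k Z A).toRingHom.toAddMonoidHom

theorem ofCoords_single (i : I) (u : PoissonEnv k Z Z) :
    ofCoords b (Finsupp.single i u) = alpha k Z A (b i) * natMap k Z A u := by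
  simp [ofCoords]

theorem ofCoords_smul (v : PoissonEnv k Z Z) (x : I →₀ PoissonEnv k Z Z) :
    ofCoords b (MulOpposite.op v • x) = ofCoords b x * natMap k Z A v := by
  induction x using Finsupp.induction_linear with
  | zero => simp
  | add x y hx hy => rw [smul_add, map_add, hx, hy, map_add, add_mul]
  | single i u =>
    rw [Finsupp.smul_single, ofCoords_single, ofCoords_single, op_smul_eq_mul, map_mul,
      mul_assoc]

theorem ofCoords_coords (h : ∀ a, Finsupp.linearCombination Z b (s a) = a)
    (x : PoissonEnv k Z A) : ofCoords b (coords s x) = x := by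
  induction x using induction_mul with
  | zero => simp
  | add x y hx hy => rw [map_add, map_add, hx, hy]
  | mul a u =>
    have h1 : ∀ v : I →₀ Z, ofCoords b (Finsupp.mapRange.linearMap
        (LinearMap.toSpanSingleton Z (PoissonEnv k Z Z) u) v) =
        alpha k Z A (Finsupp.linearCombination Z b v) * natMap k Z A u := by
      intro v
      induction v using Finsupp.induction_linear with
      | zero => simp
      | add v w hv hw => rw [map_add, map_add, hv, hw, map_add, map_add, add_mul]
      | single i r =>
        -- The image of Z is central in A, so a coefficient can pass α (b i) and move from the A
        -- side to the Z^e side.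
        rw [Finsupp.mapRange.linearMap_apply, Finsupp.mapRange_single, ofCoords_single,
          Finsupp.linearCombination_single, LinearMap.toSpanSingleton_apply, natMap_smul,
          smul_def, Algebra.smul_def, Algebra.commutes, map_mul, mul_assoc]
    rw [coords_mul_eq, h1, h]

theorem coords_ofCoords (h : ∀ i, s (b i) = Finsupp.single i 1)
    (x : I →₀ PoissonEnv k Z Z) : coords s (ofCoords b x) = x := by
  induction x using Finsupp.induction_linear with
  | zero => simp
  | add x y hx hy => rw [map_add, map_add, hx, hy]
  | single i u =>
    rw [ofCoords_single, coords_mul_eq, h]; simp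

instance free_opposite (R : Type*) [Ring R] : Module.Free Rᵐᵒᵖ R :=
  let e : Rᵐᵒᵖ ≃ₗ[Rᵐᵒᵖ] R := { MulOpposite.opAddEquiv.symm with map_smul' := fun _ _ => rfl }
  Module.Free.of_equiv e

variable (k Z A)

theorem free_right_natMap [Module.Free Z A] :
    @Module.Free (PoissonEnv k Z Z)ᵐᵒᵖ (PoissonEnv k Z A) _ _
      (natMap k Z A).toRingHom.rightModule :=
  let := (natMap k Z A).toRingHom.rightModule
  let c := Module.Free.chooseBasis Z A
  let e : (Module.Free.ChooseBasisIndex Z A →₀ PoissonEnv k Z Z) ≃ₗ[(PoissonEnv k Z Z)ᵐᵒᵖ]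
      PoissonEnv k Z A :=
    { toFun := ofCoords c
      map_add' := map_add _
      map_smul' := fun v x => ofCoords_smul c v.unop x
      invFun := coords c.repr.toLinearMap
      left_inv := coords_ofCoords c _ (fun i => c.repr_self i)
      right_inv := ofCoords_coords c _ (fun a => c.linearCombination_repr a) }
  Module.Free.of_equiv e

theorem projective_right_natMap [Module.Projective Z A] :
    @Module.Projective (PoissonEnv k Z Z)ᵐᵒᵖ _ (PoissonEnv k Z A) _
      (natMap k Z A).toRingHom.rightModule := by
  let := (natMap k Z A).toRingHom.rightModule
  obtain ⟨s, hs⟩ := Module.projective_def.1 (inferInstance : Module.Projective Z A)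
  let i : PoissonEnv k Z A →ₗ[(PoissonEnv k Z Z)ᵐᵒᵖ] (A →₀ PoissonEnv k Z Z) :=
    { coords s with map_smul' := fun v x => coords_mul_natMap s x v.unop }
  let p : (A →₀ PoissonEnv k Z Z) →ₗ[(PoissonEnv k Z Z)ᵐᵒᵖ] PoissonEnv k Z A :=
    { ofCoords id with map_smul' := fun v x => ofCoords_smul id v.unop x }
  exact Module.Projective.of_split i p (LinearMap.ext fun x => ofCoords_coords id s hs x)

end right

end PoissonEnv

/-! ### Passing to opposites -/

/-- A commutative algebra, to be endowed with the negative of a given Poisson bracket. -/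
def PoissonOp (Z : Type*) : Type _ := Z

namespace PoissonOp

instance (Z : Type*) [CommRing Z] : CommRing (PoissonOp Z) := inferInstanceAs (CommRing Z)

instance (k Z : Type*) [Field k] [CommRing Z] [Algebra k Z] : Algebra k (PoissonOp Z) :=
  inferInstanceAs (Algebra k Z)

instance (k Z : Type*) [Field k] [CommRing Z] [Algebra k Z] [h : Algebra.Smooth k Z] :
    Algebra.Smooth k (PoissonOp Z) := h

instance (Z A : Type*) [CommRing Z] [Ring A] [Algebra Z A] : Algebra (PoissonOp Z) Aᵐᵒᵖ :=
  inferInstanceAs (Algebra Z Aᵐᵒᵖ)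

variable (k Z A : Type*) [Field k] [CommRing Z] [Algebra k Z]
  [PoissonAlgebra k Z] [Ring A] [Algebra k A] [Algebra Z A] [IsScalarTower k Z A]
  [PoissonOrder k Z A]

instance : IsScalarTower k (PoissonOp Z) Aᵐᵒᵖ := inferInstanceAs (IsScalarTower k Z Aᵐᵒᵖ)

/-- The identity map. -/
def toOp : Z ≃ₐ[k] PoissonOp Z := (AlgEquiv.refl : Z ≃ₐ[k] Z)

instance : PoissonAlgebra k (PoissonOp Z) where
  bracket := (-PoissonAlgebra.bracket : Z →ₗ[k] Z →ₗ[k] Z)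
  bracket_self := fun (z : Z) => by
    change - PoissonAlgebra.bracket (k := k) z z = 0
    rw [PoissonAlgebra.bracket_self, neg_zero]
  jacobi := fun (x y z : Z) => by
    change - PoissonAlgebra.bracket (k := k) (- PoissonAlgebra.bracket (k := k) x y) z =
      - PoissonAlgebra.bracket (k := k) x (- PoissonAlgebra.bracket (k := k) y z) -
      - PoissonAlgebra.bracket (k := k) y (- PoissonAlgebra.bracket (k := k) x z)
    simp only [map_neg, LinearMap.neg_apply, neg_neg, PoissonAlgebra.jacobi]
  leibniz := fun (x y z : Z) => by
    change - PoissonAlgebra.bracket (k := k) x (y * z) =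
      (- PoissonAlgebra.bracket (k := k) x y) * z + y * (- PoissonAlgebra.bracket (k := k) x z)
    rw [PoissonAlgebra.leibniz]
    ring

/-- Reversing products changes the sign of the commutator [δ z, α a], so the Hamiltonian action must
be negated along with the bracket. -/
instance : PoissonOrder k (PoissonOp Z) Aᵐᵒᵖ where
  finite :=
    have : Module.Finite Z A := PoissonOrder.finite k
    (inferInstance : Module.Finite Z Aᵐᵒᵖ)
  ham := (LinearMap.mk₂ k
    (fun z a => - MulOpposite.op (PoissonOrder.ham (k := k) z a.unop))
    (fun x y a => by simp [add_comm]) (fun c x a => by simp)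
    (fun x a b => by simp [add_comm]) (fun c x a => by simp) : Z →ₗ[k] Aᵐᵒᵖ →ₗ[k] Aᵐᵒᵖ)
  ham_algebraMap := fun (x y : Z) => by
    change - MulOpposite.op (PoissonOrder.ham (k := k) x (algebraMap Z A y)) =
      MulOpposite.op (algebraMap Z A (- PoissonAlgebra.bracket (k := k) x y))
    rw [PoissonOrder.ham_algebraMap, map_neg, MulOpposite.op_neg]
  ham_mul := fun (z : Z) (a b : Aᵐᵒᵖ) => by
    change - MulOpposite.op (PoissonOrder.ham (k := k) z (b.unop * a.unop)) =
      - MulOpposite.op (PoissonOrder.ham (k := k) z a.unop) * b +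
      a * - MulOpposite.op (PoissonOrder.ham (k := k) z b.unop)
    rw [PoissonOrder.ham_mul, MulOpposite.op_add, MulOpposite.op_mul, MulOpposite.op_mul,
      MulOpposite.op_unop, MulOpposite.op_unop, neg_add, neg_mul, mul_neg, add_comm]
  mul_ham := fun (x y : Z) (a : Aᵐᵒᵖ) => by
    change - MulOpposite.op (PoissonOrder.ham (k := k) (x * y) a.unop) =
      x • (- MulOpposite.op (PoissonOrder.ham (k := k) y a.unop)) +
      y • (- MulOpposite.op (PoissonOrder.ham (k := k) x a.unop))
    rw [PoissonOrder.mul_ham, MulOpposite.op_add, MulOpposite.op_smul, MulOpposite.op_smul,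
      smul_neg, smul_neg, neg_add]
  ham_bracket := fun (x y : Z) (a : Aᵐᵒᵖ) => by
    change - MulOpposite.op (PoissonOrder.ham (k := k)
        (- PoissonAlgebra.bracket (k := k) x y) a.unop) =
      - MulOpposite.op (PoissonOrder.ham (k := k) x
        (- PoissonOrder.ham (k := k) y a.unop)) -
      - MulOpposite.op (PoissonOrder.ham (k := k) y
        (- PoissonOrder.ham (k := k) x a.unop))
    simp only [map_neg, LinearMap.neg_apply, MulOpposite.op_neg, neg_neg, PoissonOrder.ham_bracket,
      MulOpposite.op_sub]

end PoissonOp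

namespace PoissonEnv

/-! ### Anti-homomorphisms of enveloping algebras -/

section antiHom

variable {k Z A Z' A' : Type*} [Field k] [CommRing Z] [Algebra k Z]
  [PoissonAlgebra k Z] [Ring A] [Algebra k A] [Algebra Z A] [IsScalarTower k Z A]
  [PoissonOrder k Z A] [CommRing Z'] [Algebra k Z']
  [PoissonAlgebra k Z'] [Ring A'] [Algebra k A'] [Algebra Z' A'] [IsScalarTower k Z' A']
  [PoissonOrder k Z' A'] (σ : Z ≃ₐ[k] Z') (τ : A ≃ₐ[k] A'ᵐᵒᵖ)
  (hσ : ∀ x y, PoissonAlgebra.bracket (k := k) (σ x) (σ y) =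
    - σ (PoissonAlgebra.bracket (k := k) x y))
  (hτ : ∀ z a, PoissonOrder.ham (k := k) (σ z) (τ a).unop =
    - (τ (PoissonOrder.ham (k := k) z a)).unop)
  (hστ : ∀ z, algebraMap Z' A' (σ z) = (τ (algebraMap Z A z)).unop)

/-- Enveloping algebras of opposite Poisson orders are opposite. -/
noncomputable def antiHom : PoissonEnv k Z A →ₐ[k] (PoissonEnv k Z' A')ᵐᵒᵖ :=
  lift ((AlgHom.op (alpha k Z' A')).comp τ.toAlgHom)
    ((MulOpposite.opLinearEquiv k).toLinearMap ∘ₗ delta k Z' A' ∘ₗ σ.toLinearMap)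
    (fun x y => by
      change MulOpposite.op (delta k Z' A' (σ (PoissonAlgebra.bracket (k := k) x y))) =
        MulOpposite.op (delta k Z' A' (σ y) * delta k Z' A' (σ x) -
          delta k Z' A' (σ x) * delta k Z' A' (σ y))
      rw [← delta_bracket, PoissonAlgebra.bracket_swap, map_neg, hσ])
    (fun x a => by
      change MulOpposite.op (alpha k Z' A' (τ (PoissonOrder.ham (k := k) x a)).unop) =
        MulOpposite.op (alpha k Z' A' (τ a).unop * delta k Z' A' (σ x) -
          delta k Z' A' (σ x) * alpha k Z' A' (τ a).unop)
      rw [← neg_sub (delta k Z' A' (σ x) * _), ← alpha_ham, hτ, map_neg, neg_neg])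
    (fun x y => by
      change MulOpposite.op (delta k Z' A' (σ (x * y))) =
        MulOpposite.op (delta k Z' A' (σ y) * alpha k Z' A' (τ (algebraMap Z A x)).unop +
          delta k Z' A' (σ x) * alpha k Z' A' (τ (algebraMap Z A y)).unop)
      -- In the opposite algebra the coefficients of `delta_mul` stand on the right. Moving them
      -- left produces {x, y} and {y, x}, which cancel.
      have h : ∀ x y : Z', delta k Z' A' x * alpha k Z' A' (algebraMap Z' A' y) =
          alpha k Z' A' (algebraMap Z' A' y) * delta k Z' A' x +
            alpha k Z' A' (algebraMap Z' A' (PoissonAlgebra.bracket (k := k) x y)) := by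
        intro x y
        rw [← PoissonOrder.ham_algebraMap, alpha_ham, add_sub_cancel]
      rw [← hστ, ← hστ, map_mul, delta_mul, h, h, PoissonAlgebra.bracket_swap (σ x), map_neg,
        map_neg]
      congr 1
      abel)

theorem antiHom_alpha (a : A) : antiHom σ τ hσ hτ hστ (alpha k Z A a) =
    MulOpposite.op (alpha k Z' A' (τ a).unop) := by
  rw [antiHom, lift_alpha]; rfl

theorem antiHom_delta (z : Z) : antiHom σ τ hσ hτ hστ (delta k Z A z) =
    MulOpposite.op (delta k Z' A' (σ z)) := by
  rw [antiHom, lift_delta]; rfl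

theorem antiHom_antiHom (σ' : Z' ≃ₐ[k] Z) (τ' : A' ≃ₐ[k] Aᵐᵒᵖ)
    (hσ' : ∀ x y, PoissonAlgebra.bracket (k := k) (σ' x) (σ' y) =
      - σ' (PoissonAlgebra.bracket (k := k) x y))
    (hτ' : ∀ z a, PoissonOrder.ham (k := k) (σ' z) (τ' a).unop =
      - (τ' (PoissonOrder.ham (k := k) z a)).unop)
    (hστ' : ∀ z, algebraMap Z A (σ' z) = (τ' (algebraMap Z' A' z)).unop)
    (hσσ : ∀ z, σ' (σ z) = z) (hττ : ∀ a, (τ' (τ a).unop).unop = a) (u : PoissonEnv k Z A) :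
    (antiHom σ' τ' hσ' hτ' hστ' (antiHom σ τ hσ hτ hστ u).unop).unop = u := by
  induction u using induction_left with
  | one => simp
  | add u v hu hv => rw [map_add, MulOpposite.unop_add, map_add, MulOpposite.unop_add, hu, hv]
  | alpha_mul a u hu =>
    rw [map_mul, MulOpposite.unop_mul, map_mul, MulOpposite.unop_mul, hu, antiHom_alpha,
      MulOpposite.unop_op, antiHom_alpha, MulOpposite.unop_op, hττ]
  | delta_mul z u hu =>
    rw [map_mul, MulOpposite.unop_mul, map_mul, MulOpposite.unop_mul, hu, antiHom_delta,
      MulOpposite.unop_op, antiHom_delta, MulOpposite.unop_op, hσσ]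

end antiHom

variable (k Z A : Type*) [Field k] [CommRing Z] [Algebra k Z]
  [PoissonAlgebra k Z] [Ring A] [Algebra k A] [Algebra Z A] [IsScalarTower k Z A]
  [PoissonOrder k Z A]

open PoissonOp

/-- The enveloping algebra of the opposite of `A` is the opposite of `A^e`. -/
noncomputable def opEquiv : PoissonEnv k (PoissonOp Z) Aᵐᵒᵖ ≃+* (PoissonEnv k Z A)ᵐᵒᵖ :=
  let f := antiHom (Z := PoissonOp Z) (A := Aᵐᵒᵖ) (Z' := Z) (A' := A) (toOp k Z).symm AlgEquiv.refl
    (fun x y => (neg_neg (PoissonAlgebra.bracket (k := k) (Z := Z) x y)).symm)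
    (fun z a => (neg_neg (PoissonOrder.ham (k := k) (Z := Z) z a.unop)).symm) (fun _ => rfl)
  let g := antiHom (Z := Z) (A := A) (Z' := PoissonOp Z) (A' := Aᵐᵒᵖ) (toOp k Z)
    (AlgEquiv.opOp k A) (fun _ _ => rfl) (fun _ _ => rfl) (fun _ => rfl)
  { f with
    invFun := fun x => (g x.unop).unop
    left_inv := antiHom_antiHom _ _ _ _ _ _ _ _ _ _ (fun _ => rfl) (fun _ => rfl)
    right_inv := fun x => MulOpposite.unop_injective
      (antiHom_antiHom _ _ _ _ _ _ _ _ _ _ (fun _ => rfl) (fun _ => rfl) x.unop) }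

theorem opEquiv_alpha (a : Aᵐᵒᵖ) : opEquiv k Z A (alpha k (PoissonOp Z) Aᵐᵒᵖ a) =
    MulOpposite.op (alpha k Z A a.unop) := antiHom_alpha _ _ _ _ _ a

theorem opEquiv_delta (z : PoissonOp Z) : opEquiv k Z A (delta k (PoissonOp Z) Aᵐᵒᵖ z) =
    MulOpposite.op (delta k Z A ((toOp k Z).symm z)) := antiHom_delta _ _ _ _ _ z

/-- The enveloping algebra of `Z` with the negative bracket is the opposite of `Z^e`. -/
noncomputable def opEquivSelf :
    PoissonEnv k (PoissonOp Z) (PoissonOp Z) ≃+* (PoissonEnv k Z Z)ᵐᵒᵖ :=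
  -- `opEquiv` at A = Z would involve `Zᵐᵒᵖ` as order over `PoissonOp Z`, whereas the source of
  -- `natMap` needs `PoissonOp Z` over itself.
  let f := antiHom (Z := PoissonOp Z) (A := PoissonOp Z) (Z' := Z) (A' := Z) (toOp k Z).symm
    ((toOp k Z).symm.trans (AlgEquiv.toOpposite k Z))
    (fun x y => (neg_neg (PoissonAlgebra.bracket (k := k) (Z := Z) x y)).symm)
    (fun z a => (neg_neg (PoissonAlgebra.bracket (k := k) (Z := Z) z a)).symm) (fun _ => rfl)
  let g := antiHom (Z := Z) (A := Z) (Z' := PoissonOp Z) (A' := PoissonOp Z) (toOp k Z)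
    ((toOp k Z).trans (AlgEquiv.toOpposite k (PoissonOp Z)))
    (fun _ _ => rfl) (fun _ _ => rfl) (fun _ => rfl)
  { f with
    invFun := fun x => (g x.unop).unop
    left_inv := antiHom_antiHom _ _ _ _ _ _ _ _ _ _ (fun _ => rfl) (fun _ => rfl)
    right_inv := fun x => MulOpposite.unop_injective
      (antiHom_antiHom _ _ _ _ _ _ _ _ _ _ (fun _ => rfl) (fun _ => rfl) x.unop) }

theorem opEquivSelf_alpha (a : PoissonOp Z) :
    opEquivSelf k Z (alpha k (PoissonOp Z) (PoissonOp Z) a) =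
      MulOpposite.op (alpha k Z Z ((toOp k Z).symm a)) := antiHom_alpha _ _ _ _ _ a

theorem opEquivSelf_delta (z : PoissonOp Z) :
    opEquivSelf k Z (delta k (PoissonOp Z) (PoissonOp Z) z) =
      MulOpposite.op (delta k Z Z ((toOp k Z).symm z)) := antiHom_delta _ _ _ _ _ z

/-- This square allows the right Z^e-module structure of the opposite order to be read as a left
structure on A^e. -/
theorem opEquiv_natMap (u : PoissonEnv k (PoissonOp Z) (PoissonOp Z)) :
    opEquiv k Z A (natMap k (PoissonOp Z) Aᵐᵒᵖ u) =
      MulOpposite.op (natMap k Z A (opEquivSelf k Z u).unop) := by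
  induction u using induction_left with
  | one => simp
  | add u v hu hv => rw [map_add, map_add, hu, hv, map_add, MulOpposite.unop_add, map_add,
      MulOpposite.op_add]
  | alpha_mul a u hu =>
    rw [map_mul, map_mul, hu, natMap_alpha, opEquiv_alpha, map_mul, MulOpposite.unop_mul, map_mul,
      MulOpposite.op_mul, opEquivSelf_alpha, MulOpposite.unop_op, natMap_alpha]
    rfl
  | delta_mul a u hu =>
    rw [map_mul, map_mul, hu, natMap_delta, opEquiv_delta, map_mul, MulOpposite.unop_mul, map_mul,
      MulOpposite.op_mul, opEquivSelf_delta, MulOpposite.unop_op, natMap_delta]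

end PoissonEnv

/-! ### Transport of module properties to opposite rings -/

namespace RingHom

variable {R S R' S' : Type*} [Ring R] [Ring S] [Ring R'] [Ring S'] (f : R →+* S) (f' : R' →+* S')
  (eR : R' ≃+* Rᵐᵒᵖ) (eS : S' ≃+* Sᵐᵒᵖ) (h : ∀ r, eS (f' r) = MulOpposite.op (f (eR r).unop))

include h

/-- Through `eS`, left multiplication in `S'` becomes right multiplication in `S`, giving an
equivalence semilinear along `eR`, which preserves freeness. -/
theorem free_right_of_left (hf : @Module.Free R' S' _ _ f'.leftModule) :
    @Module.Free Rᵐᵒᵖ S _ _ f.rightModule :=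
  let := f'.leftModule
  let := f.rightModule
  let := RingHomInvPair.of_ringEquiv eR
  let := RingHomInvPair.of_ringEquiv eR.symm
  let e : S' ≃ₛₗ[(eR : R' →+* Rᵐᵒᵖ)] S :=
    { eS.toAddEquiv.trans MulOpposite.opAddEquiv.symm with
      map_smul' := fun r s => by
        change (eS (f' r * s)).unop = (eS s).unop * f (eR r).unop
        rw [map_mul, h]; rfl }
  Module.Free.of_equiv e

theorem projective_right_of_left (hf : @Module.Projective R' _ S' _ f'.leftModule) :
    @Module.Projective Rᵐᵒᵖ _ S _ f.rightModule :=
  let := f'.leftModule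
  let := f.rightModule
  let := RingHomInvPair.of_ringEquiv eR
  let := RingHomInvPair.of_ringEquiv eR.symm
  let e : S' ≃ₛₗ[(eR : R' →+* Rᵐᵒᵖ)] S :=
    { eS.toAddEquiv.trans MulOpposite.opAddEquiv.symm with
      map_smul' := fun r s => by
        change (eS (f' r * s)).unop = (eS s).unop * f (eR r).unop
        rw [map_mul, h]; rfl }
  Module.Projective.of_equiv e

theorem free_left_of_right (hf : @Module.Free R'ᵐᵒᵖ S' _ _ f'.rightModule) :
    @Module.Free R S _ _ f.leftModule :=
  let := f'.rightModule
  let := f.leftModule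
  let eR' : R'ᵐᵒᵖ ≃+* R := (RingEquiv.op eR).trans (RingEquiv.opOp R).symm
  let := RingHomInvPair.of_ringEquiv eR'
  let := RingHomInvPair.of_ringEquiv eR'.symm
  let e : S' ≃ₛₗ[(eR' : R'ᵐᵒᵖ →+* R)] S :=
    { eS.toAddEquiv.trans MulOpposite.opAddEquiv.symm with
      map_smul' := fun r s => by
        change (eS (s * f' r.unop)).unop = f (eR r.unop).unop * (eS s).unop
        rw [map_mul, h]; rfl }
  Module.Free.of_equiv e

theorem projective_left_of_right (hf : @Module.Projective R'ᵐᵒᵖ _ S' _ f'.rightModule) :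
    @Module.Projective R _ S _ f.leftModule :=
  let := f'.rightModule
  let := f.leftModule
  let eR' : R'ᵐᵒᵖ ≃+* R := (RingEquiv.op eR).trans (RingEquiv.opOp R).symm
  let := RingHomInvPair.of_ringEquiv eR'
  let := RingHomInvPair.of_ringEquiv eR'.symm
  let e : S' ≃ₛₗ[(eR' : R'ᵐᵒᵖ →+* R)] S :=
    { eS.toAddEquiv.trans MulOpposite.opAddEquiv.symm with
      map_smul' := fun r s => by
        change (eS (s * f' r.unop)).unop = f (eR r.unop).unop * (eS s).unop
        rw [map_mul, h]; rfl }
  Module.Projective.of_equiv e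

end RingHom

/-! ### Faithful flatness over noncommutative rings -/

namespace BalancedTensor

variable {R : Type u} [Ring R]

section

variable {M : Type v} {N : Type w} [AddCommGroup M] [AddCommGroup N] [Module Rᵐᵒᵖ M] [Module R N]

/-- Pure tensors. -/
noncomputable def tmul : M →+ N →+ BalancedTensor R M N where
  toFun m :=
    { toFun := fun n => QuotientAddGroup.mk (m ⊗ₜ[ℤ] n)
      map_zero' := by rw [TensorProduct.tmul_zero]; rfl
      map_add' := fun n n' => by rw [TensorProduct.tmul_add]; rfl }
  map_zero' := by
    ext n
    change QuotientAddGroup.mk ((0 : M) ⊗ₜ[ℤ] n) = _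
    rw [TensorProduct.zero_tmul]; rfl
  map_add' m m' := by
    ext n
    change QuotientAddGroup.mk ((m + m') ⊗ₜ[ℤ] n) = _
    rw [TensorProduct.add_tmul]; rfl

theorem tmul_smul (m : M) (r : R) (n : N) : (tmul (MulOpposite.op r • m) n : BalancedTensor R M N) =
    tmul m (r • n) := by
  refine QuotientAddGroup.eq_iff_sub_mem.2 (AddSubgroup.subset_closure ⟨m, r, n, rfl⟩)

theorem induction {P : BalancedTensor R M N → Prop} (zero : P 0)
    (add : ∀ t t', P t → P t' → P (t + t')) (tmul : ∀ m n, P (tmul m n))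
    (t : BalancedTensor R M N) : P t := by
  obtain ⟨t, rfl⟩ := QuotientAddGroup.mk_surjective t
  induction t using TensorProduct.induction_on with
  | zero => exact zero
  | tmul m n => exact tmul m n
  | add t t' ht ht' => exact add _ _ ht ht'

/-- The universal property of the balanced tensor product. -/
noncomputable def lift {P : Type*} [AddCommGroup P] (f : M →+ N →+ P)
    (hf : ∀ (m : M) (r : R) (n : N), f (MulOpposite.op r • m) n = f m (r • n)) :
    BalancedTensor R M N →+ P :=
  QuotientAddGroup.lift _ (TensorProduct.liftAddHom (R := ℤ) f
    (fun r m n => by rw [map_zsmul, map_zsmul]; rfl)) (by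
      rw [AddSubgroup.closure_le]
      rintro _ ⟨m, r, n, rfl⟩
      change TensorProduct.liftAddHom f _ _ = 0
      rw [map_sub, TensorProduct.liftAddHom_tmul, TensorProduct.liftAddHom_tmul, hf, sub_self])

end

section

variable {M M' : Type v} {N N' : Type w} [AddCommGroup M]
    [AddCommGroup M'] [AddCommGroup N] [AddCommGroup N'] [Module Rᵐᵒᵖ M] [Module Rᵐᵒᵖ M']
    [Module R N] [Module R N']

theorem map_tmul (f : M →ₗ[Rᵐᵒᵖ] M') (g : N →ₗ[R] N') (m : M) (n : N) :
    map f g (tmul m n) = tmul (f m) (g n) := rfl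

end

end BalancedTensor

/-- Exactness is preserved and reflected by an additive construction `T` of which the identity is
a natural direct summand, and which is itself a natural direct summand of a direct sum. -/
theorem exact_iff_of_natural_retracts {E M₁ M₂ M₃ T₁ T₂ T₃ : Type*} [AddCommGroup M₁]
    [AddCommGroup M₂] [AddCommGroup M₃] [AddCommGroup T₁] [AddCommGroup T₂] [AddCommGroup T₃]
    (f : M₁ →+ M₂) (g : M₂ →+ M₃) (F : T₁ →+ T₂) (G : T₂ →+ T₃)
    (ι₁ : M₁ →+ T₁) (ι₂ : M₂ →+ T₂) (ι₃ : M₃ →+ T₃) (κ₁ : T₁ →+ M₁) (κ₂ : T₂ →+ M₂) (κ₃ : T₃ →+ M₃)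
    (hκι₂ : ∀ m, κ₂ (ι₂ m) = m) (hκι₃ : ∀ m, κ₃ (ι₃ m) = m) (hFι : ∀ m, F (ι₁ m) = ι₂ (f m))
    (hGι : ∀ m, G (ι₂ m) = ι₃ (g m)) (hκF : ∀ t, κ₂ (F t) = f (κ₁ t))
    (B₁ : (E →₀ M₁) →+ T₁) (B₂ : (E →₀ M₂) →+ T₂) (B₃ : (E →₀ M₃) →+ T₃) (C₁ : T₁ →+ (E →₀ M₁))
    (C₂ : T₂ →+ (E →₀ M₂)) (C₃ : T₃ →+ (E →₀ M₃)) (hBC₁ : ∀ t, B₁ (C₁ t) = t)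
    (hBC₂ : ∀ t, B₂ (C₂ t) = t) (hFB : ∀ v, F (B₁ v) = B₂ (v.mapRange f f.map_zero))
    (hGB : ∀ v, G (B₂ v) = B₃ (v.mapRange g g.map_zero)) (hCG : ∀ t y, C₃ (G t) y = g (C₂ t y)) :
    Function.Exact f g ↔ Function.Exact F G := by
  classical
  constructor
  · intro hfg t
    constructor
    · intro ht
      have hker : ∀ y, ∃ m, f m = C₂ t y := fun y => (hfg _).1 (by rw [← hCG, ht]; simp)
      choose n hn using hker
      -- Lift coordinate by coordinate; choosing 0 over zero coordinates keeps the support finite.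
      let v : E →₀ M₁ := Finsupp.onFinset (C₂ t).support (fun y => if C₂ t y = 0 then 0 else n y)
        (fun y hy => by
          rw [Finsupp.mem_support_iff]; rintro h; exact hy (if_pos h))
      have hv : v.mapRange f f.map_zero = C₂ t := by
        ext y
        rw [Finsupp.mapRange_apply]
        change f (if C₂ t y = 0 then 0 else n y) = _
        split_ifs with h
        · rw [map_zero, h]
        · exact hn y
      exact ⟨B₁ v, by rw [hFB, hv, hBC₂]⟩
    · rintro ⟨t, rfl⟩
      rw [← hBC₁ t, hFB, hGB]
      convert B₃.map_zero
      ext y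
      simpa using hfg.apply_apply_eq_zero (C₁ t y)
  · intro hFG m
    constructor
    · intro hm
      -- A cycle m is embedded in T₂, bounded there, and the bounding element is projected back to
      -- M₁.
      obtain ⟨t, ht⟩ := (hFG (ι₂ m)).1 (by rw [hGι, hm, map_zero])
      exact ⟨κ₁ t, by rw [← hκF, ht, hκι₂]⟩
    · rintro ⟨m, rfl⟩
      rw [← hκι₃ (g (f m)), ← hGι, ← hFι, hFG.apply_apply_eq_zero, map_zero]

section FaithfullyFlat

open BalancedTensor

variable {R : Type u} {E : Type v} [Ring R] [AddCommGroup E]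

/-! ### Tensoring with a projective left module -/

section left

variable [Module R E] (s : E →ₗ[R] (E →₀ R)) (p : E →ₗ[R] R) {M : Type x} [AddCommGroup M]
  [Module Rᵐᵒᵖ M]

/-- Contraction with a functional on the left module. -/
noncomputable def tensorContractLeft : BalancedTensor R M E →+ M :=
  lift (AddMonoidHom.mk' (fun m => AddMonoidHom.mk' (fun e => MulOpposite.op (p e) • m)
      (fun e e' => by rw [map_add, MulOpposite.op_add, add_smul]))
      (fun m m' => by ext e; exact smul_add _ _ _)) (fun m r e => by
    change MulOpposite.op (p e) • MulOpposite.op r • m = MulOpposite.op (p (r • e)) • m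
    rw [map_smul, smul_smul]; rfl)

theorem tensorContractLeft_tmul (m : M) (e : E) :
    tensorContractLeft p (tmul m e : BalancedTensor R M E) = MulOpposite.op (p e) • m := rfl

/-- The coordinates of a tensor given by coordinates on the left module. -/
noncomputable def coordsLeft : BalancedTensor R M E →+ (E →₀ M) :=
  lift (AddMonoidHom.mk' (fun m => AddMonoidHom.mk'
      (fun e => (s e).mapRange (fun c => MulOpposite.op c • m) (by simp))
      (fun e e' => by ext y; simp [add_smul]))
      (fun m m' => by ext e y; simp)) (fun m r e => by ext y; simp [mul_smul])

theorem coordsLeft_tmul (m : M) (e : E) : coordsLeft s (tmul m e : BalancedTensor R M E) =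
    (s e).mapRange (fun c => MulOpposite.op c • m) (by simp) := rfl

/-- The tensor with given coordinates. -/
noncomputable def ofCoordsLeft (R : Type u) [Ring R] {E : Type v} [AddCommGroup E] [Module R E]
    {M : Type x} [AddCommGroup M] [Module Rᵐᵒᵖ M] : (E →₀ M) →+ BalancedTensor R M E :=
  Finsupp.liftAddHom (fun y => tmul.flip y)

theorem ofCoordsLeft_single (e : E) (m : M) :
    ofCoordsLeft R (Finsupp.single e m) = tmul m e := by
  simp [ofCoordsLeft]

theorem ofCoordsLeft_coordsLeft (hs : ∀ e, Finsupp.linearCombination R id (s e) = e)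
    (t : BalancedTensor R M E) : ofCoordsLeft R (coordsLeft s t) = t := by
  induction t using BalancedTensor.induction with
  | zero => simp
  | add t t' h h' => rw [map_add, map_add, h, h']
  | tmul m e =>
    have h2 := hs e
    rw [Finsupp.linearCombination_apply] at h2
    conv_rhs => rw [← h2]
    rw [coordsLeft_tmul, ofCoordsLeft, Finsupp.liftAddHom_apply,
      Finsupp.sum_mapRange_index (by simp), Finsupp.sum, Finsupp.sum, map_sum]
    exact Finset.sum_congr rfl fun y _ => tmul_smul m (s e y) y

theorem map_ofCoordsLeft {M' : Type x} [AddCommGroup M'] [Module Rᵐᵒᵖ M'] (f : M →ₗ[Rᵐᵒᵖ] M')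
    (v : E →₀ M) : map f (LinearMap.id : E →ₗ[R] E) (ofCoordsLeft R v) =
      ofCoordsLeft R (v.mapRange f f.map_zero) := by
  induction v using Finsupp.induction_linear with
  | zero => simp
  | add v w hv hw => rw [map_add, map_add, hv, hw, Finsupp.mapRange_add (by simp), map_add]
  | single y m => simp [ofCoordsLeft_single, map_tmul]

theorem tensorContractLeft_map {M' : Type x} [AddCommGroup M'] [Module Rᵐᵒᵖ M'] (f : M →ₗ[Rᵐᵒᵖ] M')
    (t : BalancedTensor R M E) :
    tensorContractLeft p (map f (LinearMap.id : E →ₗ[R] E) t) = f (tensorContractLeft p t) := by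
  induction t using BalancedTensor.induction with
  | zero => simp
  | add t t' h h' => simp only [map_add, h, h']
  | tmul m e => rw [map_tmul, tensorContractLeft_tmul, tensorContractLeft_tmul, map_smul, LinearMap.id_apply]

theorem coordsLeft_map {M' : Type x} [AddCommGroup M'] [Module Rᵐᵒᵖ M'] (f : M →ₗ[Rᵐᵒᵖ] M')
    (t : BalancedTensor R M E) (y : E) :
    coordsLeft s (map f (LinearMap.id : E →ₗ[R] E) t) y = f (coordsLeft s t y) := by
  induction t using BalancedTensor.induction with
  | zero => simp
  | add t t' h h' => simp only [map_add, Finsupp.add_apply, h, h']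
  | tmul m e => simp [map_tmul, coordsLeft_tmul]

/-- A projective left module which has `R` as a direct summand is faithfully flat. -/
theorem isFaithfullyFlatLeft_of_projective [Module.Projective R E] (e₀ : E) (h₀ : p e₀ = 1) :
    IsFaithfullyFlatLeft.{u, v, x} R E := by
  obtain ⟨s, hs⟩ := Module.projective_def.1 (inferInstance : Module.Projective R E)
  intro M₁ M₂ M₃ _ _ _ _ _ _ f g
  have hκι : ∀ {M : Type x} [AddCommGroup M] [Module Rᵐᵒᵖ M] (m : M),
      tensorContractLeft p (tmul.flip e₀ m : BalancedTensor R M E) = m := by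
    intro M _ _ m
    rw [AddMonoidHom.flip_apply, tensorContractLeft_tmul, h₀, MulOpposite.op_one, one_smul]
  -- The pair e₀, p makes M a natural summand of M ⊗ E, and the projective coordinates s make M ⊗ E
  -- one of M^(E).
  exact exact_iff_of_natural_retracts f.toAddMonoidHom g.toAddMonoidHom _ _
    (tmul.flip e₀) (tmul.flip e₀) (tmul.flip e₀) (tensorContractLeft p) (tensorContractLeft p) (tensorContractLeft p)
    hκι hκι (fun _ => rfl) (fun _ => rfl) (tensorContractLeft_map p f)
    (ofCoordsLeft R) (ofCoordsLeft R) (ofCoordsLeft R) (coordsLeft s) (coordsLeft s) (coordsLeft s)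
    (ofCoordsLeft_coordsLeft s hs) (ofCoordsLeft_coordsLeft s hs) (map_ofCoordsLeft f)
    (map_ofCoordsLeft g) (coordsLeft_map s g)

end left

/-! ### Tensoring with a projective right module -/

section right

variable [Module Rᵐᵒᵖ E] (s : E →ₗ[Rᵐᵒᵖ] (E →₀ Rᵐᵒᵖ)) (p : E →ₗ[Rᵐᵒᵖ] R) {N : Type x}
  [AddCommGroup N] [Module R N]

/-- Contraction with a functional on the right module. -/
noncomputable def tensorContractRight : BalancedTensor R E N →+ N :=
  lift (AddMonoidHom.mk' (fun e => AddMonoidHom.mk' (fun n => p e • n) (fun n n' => smul_add _ _ _))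
      (fun e e' => by ext n; change p (e + e') • n = _; rw [map_add, add_smul]; rfl))
      (fun e r n => by
    change p (MulOpposite.op r • e) • n = p e • r • n
    rw [map_smul, smul_smul]; rfl)

theorem tensorContractRight_tmul (e : E) (n : N) :
    tensorContractRight p (tmul e n : BalancedTensor R E N) = p e • n := rfl

/-- The coordinates of a tensor given by coordinates on the right module. -/
noncomputable def coordsRight : BalancedTensor R E N →+ (E →₀ N) :=
  lift (AddMonoidHom.mk' (fun e => AddMonoidHom.mk'
      (fun n => (s e).mapRange (fun c => c.unop • n) (by simp))
      (fun n n' => by ext y; simp))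
      (fun e e' => by ext n y; simp [add_smul])) (fun e r n => by ext y; simp [mul_smul])

theorem coordsRight_tmul (e : E) (n : N) : coordsRight s (tmul e n : BalancedTensor R E N) =
    (s e).mapRange (fun c => c.unop • n) (by simp) := rfl

/-- The tensor with given coordinates. -/
noncomputable def ofCoordsRight (R : Type u) [Ring R] {E : Type v} [AddCommGroup E] [Module Rᵐᵒᵖ E]
    {N : Type x} [AddCommGroup N] [Module R N] : (E →₀ N) →+ BalancedTensor R E N :=
  Finsupp.liftAddHom (fun y => tmul y)

theorem ofCoordsRight_single (e : E) (n : N) :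
    ofCoordsRight R (Finsupp.single e n) = tmul e n := by
  simp [ofCoordsRight]

theorem ofCoordsRight_coordsRight (hs : ∀ e, Finsupp.linearCombination Rᵐᵒᵖ id (s e) = e)
    (t : BalancedTensor R E N) : ofCoordsRight R (coordsRight s t) = t := by
  induction t using BalancedTensor.induction with
  | zero => simp
  | add t t' h h' => rw [map_add, map_add, h, h']
  | tmul e n =>
    have h2 := hs e
    rw [Finsupp.linearCombination_apply] at h2
    conv_rhs => rw [← h2]
    rw [coordsRight_tmul, ofCoordsRight, Finsupp.liftAddHom_apply,
      Finsupp.sum_mapRange_index (by simp), Finsupp.sum, Finsupp.sum, map_sum,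
      AddMonoidHom.finsetSum_apply]
    exact Finset.sum_congr rfl fun y _ => (tmul_smul y (s e y).unop n).symm

theorem map_ofCoordsRight {N' : Type x} [AddCommGroup N'] [Module R N'] (f : N →ₗ[R] N')
    (v : E →₀ N) : map (LinearMap.id : E →ₗ[Rᵐᵒᵖ] E) f (ofCoordsRight R v) =
      ofCoordsRight R (v.mapRange f f.map_zero) := by
  induction v using Finsupp.induction_linear with
  | zero => simp
  | add v w hv hw => rw [map_add, map_add, hv, hw, Finsupp.mapRange_add (by simp), map_add]
  | single y m => simp [ofCoordsRight_single, map_tmul]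

theorem tensorContractRight_map {N' : Type x} [AddCommGroup N'] [Module R N'] (f : N →ₗ[R] N')
    (t : BalancedTensor R E N) :
    tensorContractRight p (map (LinearMap.id : E →ₗ[Rᵐᵒᵖ] E) f t) = f (tensorContractRight p t) := by
  induction t using BalancedTensor.induction with
  | zero => simp
  | add t t' h h' => simp only [map_add, h, h']
  | tmul e n => rw [map_tmul, tensorContractRight_tmul, tensorContractRight_tmul, map_smul, LinearMap.id_apply]

theorem coordsRight_map {N' : Type x} [AddCommGroup N'] [Module R N'] (f : N →ₗ[R] N')
    (t : BalancedTensor R E N) (y : E) :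
    coordsRight s (map (LinearMap.id : E →ₗ[Rᵐᵒᵖ] E) f t) y = f (coordsRight s t y) := by
  induction t using BalancedTensor.induction with
  | zero => simp
  | add t t' h h' => simp only [map_add, Finsupp.add_apply, h, h']
  | tmul e n => simp [map_tmul, coordsRight_tmul]

/-- A projective right module which has `R` as a direct summand is faithfully flat. -/
theorem isFaithfullyFlatRight_of_projective [Module.Projective Rᵐᵒᵖ E] (e₀ : E) (h₀ : p e₀ = 1) :
    IsFaithfullyFlatRight.{u, v, x} R E := by
  obtain ⟨s, hs⟩ := Module.projective_def.1 (inferInstance : Module.Projective Rᵐᵒᵖ E)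
  intro N₁ N₂ N₃ _ _ _ _ _ _ f g
  have hκι : ∀ {N : Type x} [AddCommGroup N] [Module R N] (n : N),
      tensorContractRight p (tmul e₀ n : BalancedTensor R E N) = n := by
    intro N _ _ n
    rw [tensorContractRight_tmul, h₀, one_smul]
  exact exact_iff_of_natural_retracts f.toAddMonoidHom g.toAddMonoidHom _ _
    (tmul e₀) (tmul e₀) (tmul e₀) (tensorContractRight p) (tensorContractRight p) (tensorContractRight p)
    hκι hκι (fun _ => rfl) (fun _ => rfl) (tensorContractRight_map p f)
    (ofCoordsRight R) (ofCoordsRight R) (ofCoordsRight R)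
    (coordsRight s) (coordsRight s) (coordsRight s)
    (ofCoordsRight_coordsRight s hs) (ofCoordsRight_coordsRight s hs) (map_ofCoordsRight f)
    (map_ofCoordsRight g) (coordsRight_map s g)

end right

end FaithfullyFlat

/-! ### Assembling the two-sided statements -/

section main

variable (k : Type u) (Z : Type v) (A : Type w) [Field k] [CommRing Z] [Algebra k Z]
    [PoissonAlgebra k Z] [Ring A] [Algebra k A] [Algebra Z A] [IsScalarTower k Z A]
    [PoissonOrder k Z A]

namespace PoissonEnv

theorem freeBothSides_alpha [Module.Free Z (PoissonEnv k Z Z)]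
    [Module.Free (PoissonOp Z) (PoissonEnv k (PoissonOp Z) (PoissonOp Z))] :
    (alpha k Z A).toRingHom.FreeBothSides :=
  ⟨free_left_alpha k Z A, RingHom.free_right_of_left _ _ (RingEquiv.refl _) (opEquiv k Z A)
    (opEquiv_alpha k Z A) (free_left_alpha k (PoissonOp Z) Aᵐᵒᵖ)⟩

theorem freeBothSides_natMap [Module.Free Z A] : (natMap k Z A).toRingHom.FreeBothSides :=
  have : Module.Free (PoissonOp Z) Aᵐᵒᵖ := (inferInstance : Module.Free Z Aᵐᵒᵖ)
  ⟨RingHom.free_left_of_right _ _ (opEquivSelf k Z) (opEquiv k Z A)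
    (opEquiv_natMap k Z A) (free_right_natMap k (PoissonOp Z) Aᵐᵒᵖ), free_right_natMap k Z A⟩

theorem projectiveBothSides_natMap [Module.Projective Z A] :
    (natMap k Z A).toRingHom.ProjectiveBothSides :=
  have : Module.Projective Z Aᵐᵒᵖ := Module.Projective.of_equiv (MulOpposite.opLinearEquiv Z)
  have : Module.Projective (PoissonOp Z) Aᵐᵒᵖ := this
  ⟨RingHom.projective_left_of_right _ _ (opEquivSelf k Z) (opEquiv k Z A)
    (opEquiv_natMap k Z A) (projective_right_natMap k (PoissonOp Z) Aᵐᵒᵖ),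
    projective_right_natMap k Z A⟩

variable [Algebra.Smooth k Z]

theorem projectiveBothSides_alpha : (alpha k Z A).toRingHom.ProjectiveBothSides :=
  ⟨projective_left_alpha k Z A, RingHom.projective_right_of_left _ _ (RingEquiv.refl _)
    (opEquiv k Z A) (opEquiv_alpha k Z A) (projective_left_alpha k (PoissonOp Z) Aᵐᵒᵖ)⟩

theorem faithfullyFlatBothSides_alpha :
    RingHom.FaithfullyFlatBothSides.{w, max u v w, x} (alpha k Z A).toRingHom := by
  constructor
  · let := (alpha k Z A).toRingHom.leftModule
    have : Module.Projective A (PoissonEnv k Z A) := (projectiveBothSides_alpha k Z A).1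
    let p : PoissonEnv k Z A →ₗ[A] A :=
      { toFun := aug, map_add' := aug_add, map_smul' := aug_alpha_mul }
    exact isFaithfullyFlatLeft_of_projective p 1 aug_one
  · let := (alpha k Z A).toRingHom.rightModule
    have : Module.Projective Aᵐᵒᵖ (PoissonEnv k Z A) := (projectiveBothSides_alpha k Z A).2
    -- `aug` is only left linear; the augmentation of the opposite order supplies the right linear
    -- retraction.
    let p : PoissonEnv k Z A →ₗ[Aᵐᵒᵖ] A :=
      { toFun := fun y => (aug ((opEquiv k Z A).symm (MulOpposite.op y))).unop
        map_add' := fun y y' => by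
          rw [MulOpposite.op_add, map_add, aug_add, MulOpposite.unop_add]
        map_smul' := fun a y => by
          change (aug ((opEquiv k Z A).symm (MulOpposite.op (y * alpha k Z A a.unop)))).unop =
            (aug ((opEquiv k Z A).symm (MulOpposite.op y))).unop * a.unop
          rw [MulOpposite.op_mul, map_mul, ← opEquiv_alpha, RingEquiv.symm_apply_apply,
            aug_alpha_mul, MulOpposite.unop_mul] }
    refine isFaithfullyFlatRight_of_projective p 1 ?_
    change (aug ((opEquiv k Z A).symm 1)).unop = 1
    rw [map_one, aug_one, MulOpposite.unop_one]

end PoissonEnv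

end main

theorem corollaryC (k : Type u) (Z : Type v) (A : Type w) [Field k] [CommRing Z] [Algebra k Z]
    [PoissonAlgebra k Z] [Ring A] [Algebra k A] [Algebra Z A] [IsScalarTower k Z A]
    [PoissonOrder k Z A] [Algebra.Smooth k Z] :
    (Function.Injective (algebraMap Z A) → Function.Injective (PoissonEnv.natMap k Z A)) ∧
    (Module.Free Z A → (PoissonEnv.natMap k Z A).toRingHom.FreeBothSides) ∧
    (Module.Projective Z A → (PoissonEnv.natMap k Z A).toRingHom.ProjectiveBothSides) ∧
    (((∀ p : PrimeSpectrum Z, Module.rankAtStalk (Ω[Z⁄k]) p = 0) ∨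
        (∀ p : PrimeSpectrum Z, Module.rankAtStalk (Ω[Z⁄k]) p ≠ 0)) →
      (PoissonEnv.alpha k Z A).toRingHom.FreeBothSides) ∧
    (PoissonEnv.alpha k Z A).toRingHom.ProjectiveBothSides ∧
    RingHom.FaithfullyFlatBothSides.{w, max u v w, x}
      (PoissonEnv.alpha k Z A).toRingHom := by
  refine ⟨PoissonEnv.natMap_injective, fun _ => PoissonEnv.freeBothSides_natMap k Z A,
    fun _ => PoissonEnv.projectiveBothSides_natMap k Z A, ?_,
    PoissonEnv.projectiveBothSides_alpha k Z A, PoissonEnv.faithfullyFlatBothSides_alpha k Z A⟩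
  rintro (h | h)
  · have := PoissonEnv.free_of_rank_eq_zero k Z h
    -- Kähler differentials do not see the bracket, so the rank hypothesis serves for the negated
    -- bracket as well.
    have := PoissonEnv.free_of_rank_eq_zero k (PoissonOp Z) h
    exact PoissonEnv.freeBothSides_alpha k Z A
  · have := PoissonEnv.free_of_rank_ne_zero k Z h
    have := PoissonEnv.free_of_rank_ne_zero k (PoissonOp Z) h
    exact PoissonEnv.freeBothSides_alpha k Z A
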